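/- **Conventions.** Differences of extended reals use $(+\infty)-(+\infty)=+\infty$ and $(-\infty)-(-\infty)=+\infty$; also $0\cdot(\pm\infty)=0$. A *rough spacetime* is a set $M$ with a function $\ell\colon M\times M\to\{-\infty\}\cup[0,+\infty]$ such that $\ell(x,y)\le \ell(x,z)-\ell(y,z)$ and $\ell(x,x)\ge 0$ for all $x,y,z\in M$. Write $x\le y$ if $\ell(x,y)\ge 0$ and $x\ll y$ if $\ell(x,y)>0$. The *chronological topology* is the coarsest one in which all sets $\{y : x\ll y\}$ and $\{y : y\ll x\}$, $x\in M$, are open. The space is a *forward metric spacetime* if this topology is Polish, $\{\ell\ge 0\}$ is closed in $M\times M$, and every sequence $(y_i)_{i\in\mathbf Z}$ with $x\le y_i\le y_{i+1}\le z$ for some $x,z\in M$ and all $i$ has a limit as $i\to+\infty$. A *forward metric measure spacetime* $(M,\ell,\mathfrak m)$ is a forward metric spacetime with a Radon (equivalently, locally finite Borel) measure $\mathfrak m$; $\operatorname{spt}\mathfrak m$ is its support. $\mathrm{LCC}([0,1];M)$ is the set of left-continuous maps $\gamma\colon[0,1]\to M$ with $\gamma_s\le\gamma_t$ for $s\le t$,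 with the $\sigma$-algebra generated by the evaluations $\gamma\mapsto\gamma_t$ (this is the Borel $\sigma$-algebra of the distance $d(\gamma_0,\eta_0)+\int_0^1 d(\gamma_t,\eta_t)\,dt$, for any bounded metric $d$ inducing the topology of $M$). If $\ell<+\infty$, the *causal speed* $|\dot\gamma|$ of $\gamma$ is the density of the Lebesgue-absolutely continuous part of the largest Borel measure $\nu$ on $\mathbf R$ with $\nu((a,b))\le\ell(\gamma_a,\gamma_b)$ for all $a\le b$, where $\gamma_a:=\gamma_0$ for $a<0$ and $\gamma_b:=\gamma_1$ for $b>1$. A *test plan* is a probability measure $\pi$ on $\mathrm{LCC}([0,1];M)$ such that for some $C>0$ the law of $\gamma_t$ under $\pi$ is at most $C\mathfrak m$ for every $t\in[0,1]$. A function $f$ is *causal* if it is $\mathfrak m$-measurable, takes values in $[-\infty,+\infty]$, and $x\le y$ implies $f(x)\le f(y)$. An $\mathfrak m$-measurable $G\ge 0$ (with values in $[0,+\infty]$) is a *weak subslope* of $f$ if $$\int [f(\gamma_1)-f(\gamma_0)]\,d\pi(\gamma)\ \ge\ \iint_0^1 G(\gamma_t)\,|\dot\gamma_t|\,dt\,d\pi(\gamma)$$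 for every test plan $\pi$. The *maximal weak subslope* $|df|$ is the $\mathfrak m$-a.e. unique weak subslope of $f$ that is $\mathfrak m$-a.e. no smaller than any other one. Test plans are concentrated on paths in $\operatorname{spt}\mathfrak m$, so $|df|$ is also defined for causal $f\colon\operatorname{spt}\mathfrak m\to[-\infty,+\infty]$. The space has the *Sobolev-to-steepness property* if every causal $f\colon M\to[-\infty,+\infty]$ with $|df|\ge 1$ $\mathfrak m$-a.e. satisfies $f(y)-f(x)\ge\ell(x,y)$ for all $x,y\in\operatorname{spt}\mathfrak m$. **Theorem 5.24 (Nonsmooth Hawking–King–McCarthy theorem).** Let $(M_1,\ell_1,\mathfrak m_1)$ and $(M_2,\ell_2,\mathfrak m_2)$ be forward metric measure spacetimes with the Sobolev-to-steepness property, such that $(\ell_i)_+=\max\{\ell_i,0\}$ is upper semicontinuous and finite on $M_i\times M_i$ for $i=1,2$. Let $T\colon\operatorname{spt}\mathfrak m_1\to\operatorname{spt}\mathfrak m_2$ be a surjective Borel map with $T_\#\mathfrak m_1=\mathfrak m_2$. Then the following are equivalent. (i) $\ell_2(T(x),T(y))=\ell_1(x,y)$ for all $x,y\in\operatorname{spt}\mathfrak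 m_1$. (ii) Both of the following hold: - for all $x,y\in\operatorname{spt}\mathfrak m_1$, $x\le_1 y$ if and only if $T(x)\le_2 T(y)$; - for every causal function $f\colon M_2\to[-\infty,+\infty]$, $|d(f\circ T)|_1=|df|_2\circ T$ holds $\mathfrak m_1$-a.e. -/

import Mathlib

open MeasureTheory Set Filter Topology
open scoped ENNReal NNReal

/-! ## Extended differences -/

/-- The difference `a - b` of extended reals with the conventions
`(+∞) - (+∞) = +∞` and `(-∞) - (-∞) = +∞`.
(The subtraction of `EReal` gives `-∞` in these two cases; in all other cases both agree.) -/
noncomputable def extDiff (a b : EReal) : EReal := -(b - a)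

theorem extDiff_top_top : extDiff ⊤ ⊤ = ⊤ := by simp [extDiff]

theorem extDiff_bot_bot : extDiff ⊥ ⊥ = ⊤ := by simp [extDiff]

theorem extDiff_eq_sub {a b : EReal} (h₁ : a ≠ ⊤ ∨ b ≠ ⊤) (h₂ : a ≠ ⊥ ∨ b ≠ ⊥) :
    extDiff a b = a - b := by
  have h₁' : b ≠ ⊤ ∨ a ≠ ⊤ := h₁.symm
  have h₂' : b ≠ ⊥ ∨ a ≠ ⊥ := h₂.symm
  rw [extDiff, EReal.neg_sub h₂' h₁', add_comm, sub_eq_add_neg]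

/-- An inequality against the extended difference is the additive inequality in `EReal`, where
`-∞` is absorbing for the addition. -/
theorem le_extDiff_iff {a b c : EReal} : a ≤ extDiff c b ↔ a + b ≤ c := by
  rw [extDiff, EReal.le_neg]
  induction a <;> induction b <;> induction c <;>
    simp [← EReal.coe_add, ← EReal.coe_sub, ← EReal.coe_neg]

/-! ## Spacetimes

Throughout, `ℓ : M → M → EReal` is the time separation function, `x ≪ y` means `0 < ℓ x y`, and
`x ≤ y` means `0 ≤ ℓ x y`. -/

section Spacetime

variable {M : Type*}

/-- Rough spacetime: `ℓ` takes values in `{-∞} ∪ [0, +∞]`, obeys the reverse triangle inequality,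
and is nonnegative on the diagonal. -/
structure IsRoughSpacetime (ℓ : M → M → EReal) : Prop where
  eq_bot_or_nonneg : ∀ x y, ℓ x y = ⊥ ∨ 0 ≤ ℓ x y
  reverse_triangle : ∀ x y z, ℓ x y ≤ extDiff (ℓ x z) (ℓ y z)
  diag_nonneg : ∀ x, 0 ≤ ℓ x x

/-- The coarsest topology in which all chronological futures and pasts are open. -/
@[reducible]
def chronologicalTopology (ℓ : M → M → EReal) : TopologicalSpace M :=
  TopologicalSpace.generateFrom
    ({s | ∃ x, s = {y | 0 < ℓ x y}} ∪ {s | ∃ x, s = {y | 0 < ℓ y x}})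

/-- Forward metric spacetime: the topology of `M` is the chronological topology, it is Polish, the
causal relation is closed, and every monotone order-bounded sequence has a forward limit. -/
structure IsForwardMetricSpacetime [t : TopologicalSpace M] (ℓ : M → M → EReal) : Prop
    extends IsRoughSpacetime ℓ where
  topology_eq : t = chronologicalTopology ℓ
  polish : PolishSpace M
  forward_complete : ∀ (y : ℤ → M) (x z : M), (∀ i, 0 ≤ ℓ x (y i)) →
    (∀ i, 0 ≤ ℓ (y i) (y (i + 1))) → (∀ i, 0 ≤ ℓ (y i) z) → ∃ w, Tendsto y atTop (𝓝 w)
  isClosed_causal : IsClosed {p : M × M | 0 ≤ ℓ p.1 p.2}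

/-! ## Left-continuous causal paths and their causal speed -/

/-- Left-continuous causal paths `γ : [0, 1] → M`. -/
structure LCC [TopologicalSpace M] (ℓ : M → M → EReal) where
  toFun : unitInterval → M
  causal' : ∀ s t, s ≤ t → 0 ≤ ℓ (toFun s) (toFun t)
  left_continuous' : ∀ t, 0 < t → Tendsto toFun (𝓝[<] t) (𝓝 (toFun t))

instance [TopologicalSpace M] (ℓ : M → M → EReal) : CoeFun (LCC ℓ) (fun _ => unitInterval → M) :=
  ⟨LCC.toFun⟩

/-- The σ-algebra generated by the evaluations `γ ↦ γ t`.

On a forward metric spacetime this is the Borel σ-algebra of the (separable) distance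
`D γ η = d (γ 0) (η 0) + ∫₀¹ d (γ t) (η t) dt`, for any bounded metric `d` that induces the topology
of `M`: by left-continuity, evaluations are limits of averages over `[t - ε, t]`, so they are
`D`-Borel; conversely `(γ, t) ↦ γ t` is jointly measurable for the σ-algebra below, hence so is
every function `γ ↦ D γ η`, and balls generate the Borel sets of a separable metric space. -/
instance [TopologicalSpace M] [MeasurableSpace M] (ℓ : M → M → EReal) : MeasurableSpace (LCC ℓ) :=
  MeasurableSpace.comap LCC.toFun MeasurableSpace.pi

/-- The causal speed of a path as a measure: the largest Borel measure `ν` on `ℝ` such that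
`ν (a, b) ≤ ℓ (γ a) (γ b)` for all `a ≤ b`, where `γ` is extended to `ℝ` by the constants `γ 0` on
the left and `γ 1` on the right.

These measures are closed under suprema because `ℓ` is superadditive along `γ`, so this supremum is
attained. It is carried by `[0, 1]` and finite if `ℓ` does not take the value `+∞`, the only case
in which it is used. -/
noncomputable def causalSpeedMeasure [TopologicalSpace M] {ℓ : M → M → EReal} (γ : LCC ℓ) :
    Measure ℝ :=
  sSup {ν : Measure ℝ | ∀ a b : ℝ, a ≤ b →
    ν (Ioo a b) ≤
      (ℓ (γ (projIcc 0 1 zero_le_one a)) (γ (projIcc 0 1 zero_le_one b))).toENNReal}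

/-- The causal speed `|γ'|` of a path: the Lebesgue density of the absolutely continuous part of
the causal speed measure. -/
noncomputable def causalSpeed [TopologicalSpace M] {ℓ : M → M → EReal} (γ : LCC ℓ) (t : ℝ) : ℝ≥0∞ :=
  (causalSpeedMeasure γ).rnDeriv volume t

/-! ## Test plans, causal functions, maximal weak subslopes -/

/-- Test plans: probability measures on paths whose time marginals are uniformly bounded by a
multiple of the reference measure. -/
structure IsTestPlan [TopologicalSpace M] [MeasurableSpace M] {ℓ : M → M → EReal} (m : Measure M)
    (π : Measure (LCC ℓ)) : Prop where
  isProbabilityMeasure : IsProbabilityMeasure π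
  bounded_compression : ∃ C : ℝ≥0, 0 < C ∧
    ∀ t : unitInterval, π.map (fun γ : LCC ℓ => γ t) ≤ (C : ℝ≥0∞) • m

/-- `G` is a weak subslope of `f`: it is `m`-measurable and, for every test plan `π`,
`∫ (f (γ 1) - f (γ 0)) dπ(γ) ≥ ∫∫₀¹ G (γ t) |γ'| (t) dt dπ(γ)`.

For `f` nondecreasing along `≤` (on the support of `m`) the left integrand is nonnegative `π`-a.e.,
thanks to the conventions in `extDiff`. Test plans are concentrated on paths in the support of `m`,
so only the values of `f` on that support matter. -/
def IsWeakSubslope [TopologicalSpace M] [MeasurableSpace M] (ℓ : M → M → EReal) (m : Measure M)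
    (f : M → EReal) (G : M → ℝ≥0∞) : Prop :=
  AEMeasurable G m ∧ ∀ π : Measure (LCC ℓ), IsTestPlan m π →
    ∫⁻ γ, (∫⁻ t : unitInterval, G (γ t) * causalSpeed γ (t : ℝ) ∂volume) ∂π ≤
      ∫⁻ γ, (extDiff (f (γ 1)) (f (γ 0))).toENNReal ∂π

/-- `G` is a weak subslope of `f` that is `m`-a.e. no smaller than any other weak subslope. -/
def IsMaximalWeakSubslope [TopologicalSpace M] [MeasurableSpace M] (ℓ : M → M → EReal)
    (m : Measure M) (f : M → EReal) (G : M → ℝ≥0∞) : Prop :=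
  IsWeakSubslope ℓ m f G ∧ ∀ G', IsWeakSubslope ℓ m f G' → G' ≤ᵐ[m] G

open Classical in
/-- The maximal weak subslope `|df|`: a version of the `m`-a.e. unique function singled out by
`IsMaximalWeakSubslope` (and `0` for functions `f` without one). -/
noncomputable def maxWeakSubslope [TopologicalSpace M] [MeasurableSpace M] (ℓ : M → M → EReal)
    (m : Measure M) (f : M → EReal) : M → ℝ≥0∞ :=
  if h : ∃ G, IsMaximalWeakSubslope ℓ m f G then h.choose else 0

/-- Causal functions with respect to `m`: `m`-measurable and nondecreasing along `≤`. -/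
structure IsCausalFunction [MeasurableSpace M] (ℓ : M → M → EReal) (m : Measure M)
    (f : M → EReal) : Prop where
  aemeasurable : AEMeasurable f m
  monotone : ∀ x y, 0 ≤ ℓ x y → f x ≤ f y

/-- Sobolev-to-steepness: every causal function with `|df| ≥ 1` `m`-a.e. satisfies
`f y - f x ≥ ℓ x y` for all `x, y` in the support of `m`. -/
def SobolevToSteepness [TopologicalSpace M] [MeasurableSpace M] (ℓ : M → M → EReal)
    (m : Measure M) : Prop :=
  ∀ f : M → EReal, IsCausalFunction ℓ m f → (∀ᵐ x ∂m, 1 ≤ maxWeakSubslope ℓ m f x) →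
    ∀ x ∈ m.support, ∀ y ∈ m.support, ℓ x y ≤ extDiff (f y) (f x)

/-- A function on the support of `m`, seen as a function on `M`. Weak subslopes do not depend on
its values outside of the support, which are set to `-∞`. -/
noncomputable def extendSupport [TopologicalSpace M] [MeasurableSpace M] {m : Measure M}
    (g : m.support → EReal) : M → EReal :=
  Function.extend Subtype.val g (fun _ => ⊥)

end Spacetime

/-!
# Isometries of metric measure spacetimes and maximal weak subslopes

The implication from slopes to the time separation is a duality argument. The function
`f = ℓ p ·` is steep, i.e. `ℓ x y ≤ f y - f x`, so `1` is a weak subslope of it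
(`isWeakSubslope_one`: a causal path has at most the length `ℓ (γ 0) (γ 1)`). Hence `|df| ≥ 1`, a
bound that is carried to the other space by the hypothesis on slopes, where the
Sobolev-to-steepness property turns it into a comparison of time separations. Pulling back
`ℓ₂ (T x) ·` gives `ℓ₁ x y ≤ ℓ₂ (T x) (T y)`, and pushing forward `ℓ₁ x ·` gives the reverse
inequality. Functions on the support are extended to causal functions by a supremum over pasts
(`exists_isCausalFunction_extension`), and `T` has a Borel inverse by the Lusin–Souslin theorem,
since the causal relation is antisymmetric (`IsForwardMetricSpacetime.causal_antisymm`).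

Conversely, a map that preserves the time separation pushes test plans to test plans and preserves
causal speeds, so it transports weak subslopes (`IsWeakSubslope.of_comp`). No continuity of `T` is
assumed; forward completeness and the order alone show that images of left-continuous causal
paths are left-continuous (`tendsto_comp_of_orderEmbedding`).

Both implications need that a causal function has a maximal weak subslope
(`exists_isMaximalWeakSubslope`). This rests on a differentiation theory for superadditive functions
`F a b` of intervals, such as the time separation or the increment of a causal function along a
causal path. Bounded ones have a largest measure below them (`sSup_mem_intervalMinorants`), and the
density of its absolutely continuous part is a lower limit of difference quotients over grid cells
(`rnDeriv_sSup_intervalMinorants`). This makes the causal speed jointly measurable in the path and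
the time. The inequality that defines weak subslopes localizes to subintervals and to almost every
path (`IsWeakSubslope.ae_setLIntegral_le`), hence by differentiation to the pointwise inequality
`G (γ t) |γ'| t ≤ (f ∘ γ)' t` (`isWeakSubslope_iff_ae`), which is stable under countable suprema.
-/

/-! ### Superadditive interval functions -/

/-- Superadditivity of an interval function `F a b`, thought of as a size of the interval between
`a ≤ b`. -/
def IntervalSuperadditive (F : ℝ → ℝ → ℝ≥0∞) : Prop :=
  ∀ a b c, a ≤ b → b ≤ c → F a b + F b c ≤ F a c

/-- The Borel measures on `ℝ` that are bounded by an interval function on all open intervals. -/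
def intervalMinorants (F : ℝ → ℝ → ℝ≥0∞) : Set (Measure ℝ) :=
  {ν | ∀ a b : ℝ, a ≤ b → ν (Ioo a b) ≤ F a b}

theorem IntervalSuperadditive.mono {F : ℝ → ℝ → ℝ≥0∞} (hF : IntervalSuperadditive F)
    {a b c d : ℝ} (hac : a ≤ c) (hcd : c ≤ d) (hdb : d ≤ b) : F c d ≤ F a b :=
  calc F c d ≤ F c d + F d b := le_self_add
    _ ≤ F c b := hF _ _ _ hcd hdb
    _ ≤ F a c + F c b := le_add_self
    _ ≤ F a b := hF _ _ _ hac (hcd.trans hdb)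

theorem isFiniteMeasure_of_mem_intervalMinorants {F : ℝ → ℝ → ℝ≥0∞} {C : ℝ≥0∞} (hC : C ≠ ⊤)
    (hFC : ∀ a b, a ≤ b → F a b ≤ C) {ν : Measure ℝ} (hν : ν ∈ intervalMinorants F) :
    IsFiniteMeasure ν := by
  refine ⟨lt_of_le_of_lt ?_ hC.lt_top⟩
  have hU : (⋃ n : ℕ, Ioo (-(n : ℝ)) n) = univ := by
    refine eq_univ_of_forall fun x => ?_
    obtain ⟨n, hn⟩ := exists_nat_gt |x|
    exact mem_iUnion.2 ⟨n, abs_lt.1 hn⟩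
  have hmono : Monotone fun n : ℕ => Ioo (-(n : ℝ)) n := fun i j hij =>
    Ioo_subset_Ioo (by simpa using hij) (by simpa using hij)
  rw [← hU, hmono.measure_iUnion]
  exact iSup_le fun n => (hν _ _ (by linarith [n.cast_nonneg (α := ℝ)])).trans
    (hFC _ _ (by linarith [n.cast_nonneg (α := ℝ)]))

theorem exists_common_nonatom (μ ν : Measure ℝ) [IsFiniteMeasure μ] [IsFiniteMeasure ν] {c d : ℝ}
    (h : c < d) : ∃ x ∈ Ioo c d, μ {x} = 0 ∧ ν {x} = 0 := by
  have hc : {x : ℝ | 0 < (μ + ν) {x}}.Countable :=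
    Measure.countable_meas_pos_of_disjoint_iUnion (fun _ => measurableSet_singleton _)
      fun x y hxy => disjoint_singleton.2 hxy
  obtain ⟨x, hx, hx'⟩ := (hc.dense_compl ℝ).exists_mem_open isOpen_Ioo (nonempty_Ioo.2 h)
  have : (μ + ν) {x} = 0 := by simpa using hx
  rw [Measure.add_apply, add_eq_zero] at this
  exact ⟨x, hx', this⟩

/-- Two minorants of `F`, placed on disjoint compact sets, add up to at most `F`: the compact sets
have a positive distance, so an interval can be cut into pieces that meet at most one of them. The
cuts are made outside of the atoms of both measures, so nothing is lost at the endpoints. -/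
theorem add_le_of_disjoint_isCompact {F : ℝ → ℝ → ℝ≥0∞} (hF : IntervalSuperadditive F)
    {μ ν : Measure ℝ} [IsFiniteMeasure μ] [IsFiniteMeasure ν] (hμ : μ ∈ intervalMinorants F)
    (hν : ν ∈ intervalMinorants F) {K L : Set ℝ} (hK : IsCompact K) (hL : IsCompact L)
    (hKL : Disjoint K L) {a b : ℝ} (hab : a ≤ b) :
    μ (K ∩ Ioo a b) + ν (L ∩ Ioo a b) ≤ F a b := by
  obtain ⟨r, hr, hr'⟩ := Metric.exists_pos_forall_lt_edist hK hL.isClosed hKL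
  have hr0 : (0 : ℝ) < r := hr
  have hdist : ∀ x ∈ K, ∀ y ∈ L, (r : ℝ) < |x - y| := fun x hx y hy => by
    have := hr' x hx y hy
    rw [edist_nndist, ENNReal.coe_lt_coe] at this
    rw [← Real.dist_eq]
    exact_mod_cast this
  have base : ∀ a b : ℝ, a ≤ b → b - a ≤ r → μ (K ∩ Ioo a b) + ν (L ∩ Ioo a b) ≤ F a b := by
    intro a b hab hb
    rcases (K ∩ Ioo a b).eq_empty_or_nonempty with h | ⟨x, hxK, hx⟩
    · rw [h, measure_empty, zero_add]
      exact (measure_mono inter_subset_right).trans (hν _ _ hab)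
    · have : L ∩ Ioo a b = ∅ := by
        refine eq_empty_of_forall_notMem fun y hy => ?_
        have h1 := hdist x hxK y hy.1
        have h2 : |x - y| < r := by
          rw [abs_lt]
          constructor <;> linarith [hx.1, hx.2, hy.2.1, hy.2.2]
        linarith
      rw [this, measure_empty, add_zero]
      exact (measure_mono inter_subset_right).trans (hμ _ _ hab)
  have step : ∀ n : ℕ, ∀ a b : ℝ, a ≤ b → b - a ≤ r + n * (r / 2) →
      μ (K ∩ Ioo a b) + ν (L ∩ Ioo a b) ≤ F a b := by
    intro n
    induction n with
    | zero => intro a b hab hb; exact base a b hab (by simpa using hb)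
    | succ n ih =>
      intro a b hab hb
      rcases le_or_gt (b - a) r with h | h
      · exact base a b hab h
      obtain ⟨c, hc, hcμ, hcν⟩ := exists_common_nonatom μ ν
        (show b - r < b - r / 2 by linarith)
      push_cast at hb
      have hac : a ≤ c := by linarith [hc.1]
      have hcb : c ≤ b := by linarith [hc.2]
      have key : ∀ (ρ : Measure ℝ) (A : Set ℝ), ρ {c} = 0 →
          ρ (A ∩ Ioo a b) ≤ ρ (A ∩ Ioo a c) + ρ (A ∩ Ioo c b) := by
        intro ρ A hρ
        have hsub : A ∩ Ioo a b ⊆ ((A ∩ Ioo a c) ∪ (A ∩ Ioo c b)) ∪ {c} := by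
          rintro x ⟨hxA, hx⟩
          rcases lt_trichotomy x c with h | h | h
          · exact Or.inl (Or.inl ⟨hxA, hx.1, h⟩)
          · exact Or.inr h
          · exact Or.inl (Or.inr ⟨hxA, h, hx.2⟩)
        calc ρ (A ∩ Ioo a b) ≤ _ := measure_mono hsub
          _ ≤ _ := measure_union_le _ _
          _ ≤ ρ (A ∩ Ioo a c) + ρ (A ∩ Ioo c b) := by
            rw [hρ, add_zero]
            exact measure_union_le _ _
      calc μ (K ∩ Ioo a b) + ν (L ∩ Ioo a b)
          ≤ (μ (K ∩ Ioo a c) + μ (K ∩ Ioo c b)) + (ν (L ∩ Ioo a c) + ν (L ∩ Ioo c b)) :=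
            add_le_add (key μ K hcμ) (key ν L hcν)
        _ = (μ (K ∩ Ioo a c) + ν (L ∩ Ioo a c)) + (μ (K ∩ Ioo c b) + ν (L ∩ Ioo c b)) :=
            add_add_add_comm _ _ _ _
        _ ≤ F a c + F c b :=
            add_le_add (ih a c hac (by linarith [hc.2])) (base c b hcb (by linarith [hc.1]))
        _ ≤ F a b := hF _ _ _ hac hcb
  obtain ⟨n, hn⟩ := exists_nat_gt ((b - a) / (r / 2))
  rw [div_lt_iff₀ (by positivity)] at hn
  exact step n a b hab (by linarith)

/-- The minorants of a bounded superadditive interval function are directed: glue two of them along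
a Hahn decomposition of their difference. -/
theorem directedOn_intervalMinorants {F : ℝ → ℝ → ℝ≥0∞} (hF : IntervalSuperadditive F)
    {C : ℝ≥0∞} (hC : C ≠ ⊤) (hFC : ∀ a b, a ≤ b → F a b ≤ C) :
    DirectedOn (· ≤ ·) (intervalMinorants F) := by
  intro μ hμ ν hν
  have := isFiniteMeasure_of_mem_intervalMinorants hC hFC hμ
  have := isFiniteMeasure_of_mem_intervalMinorants hC hFC hν
  obtain ⟨s, hs, h1, h2⟩ := hahn_decomposition μ ν
  refine ⟨μ.restrict s + ν.restrict sᶜ, ?_, ?_, ?_⟩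
  · intro a b hab
    rw [Measure.add_apply, Measure.restrict_apply measurableSet_Ioo,
      Measure.restrict_apply measurableSet_Ioo,
      (measurableSet_Ioo.inter hs).measure_eq_iSup_isCompact,
      (measurableSet_Ioo.inter hs.compl).measure_eq_iSup_isCompact]
    simp only [iSup_and']
    refine ENNReal.biSup_add_biSup_le' (p := fun K => K ⊆ Ioo a b ∩ s ∧ IsCompact K)
      (q := fun K => K ⊆ Ioo a b ∩ sᶜ ∧ IsCompact K)
      ⟨∅, empty_subset _, isCompact_empty⟩ ⟨∅, empty_subset _, isCompact_empty⟩ ?_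
    rintro K ⟨hK, hKc⟩ L ⟨hL, hLc⟩
    have := add_le_of_disjoint_isCompact hF hμ hν hKc hLc
      (disjoint_compl_right.mono (hK.trans inter_subset_right) (hL.trans inter_subset_right)) hab
    rwa [inter_eq_left.2 (hK.trans inter_subset_left),
      inter_eq_left.2 (hL.trans inter_subset_left)] at this
  · refine Measure.le_iff.2 fun t ht => ?_
    rw [Measure.add_apply, Measure.restrict_apply ht, Measure.restrict_apply ht,
      ← measure_inter_add_sdiff t hs]
    exact add_le_add le_rfl (h2 _ (ht.diff hs) fun x hx => hx.2)
  · refine Measure.le_iff.2 fun t ht => ?_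
    rw [Measure.add_apply, Measure.restrict_apply ht, Measure.restrict_apply ht,
      ← measure_inter_add_sdiff t hs]
    exact add_le_add (h1 _ (ht.inter hs) inter_subset_right) le_rfl

/-- On measurable sets, the supremum of a directed set of measures is at most the supremum of the
values. -/
theorem sSup_apply_le_of_directedOn {α : Type*} [MeasurableSpace α] {S : Set (Measure α)}
    (hS : DirectedOn (· ≤ ·) S) (hne : S.Nonempty) {A : Set α} (hA : MeasurableSet A) {c : ℝ≥0∞}
    (hc : ∀ ν ∈ S, ν A ≤ c) : sSup S A ≤ c := by
  have hdir : Directed (· ≤ ·) (Subtype.val : S → Measure α) := hS.directed_val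
  have hne' : Nonempty S := hne.to_subtype
  let μ : Measure α := Measure.ofMeasurable (fun B _ => ⨆ ν : S, ν.1 B) (by simp) (by
    intro f hf hd
    have : ∀ ν : S, ν.1 (⋃ i, f i) = ∑' i, ν.1 (f i) := fun ν => measure_iUnion hd hf
    simp only [this, ENNReal.tsum_eq_iSup_sum]
    rw [iSup_comm]
    congr 1
    ext s
    refine (ENNReal.finsetSum_iSup fun ν ρ => ?_).symm
    obtain ⟨κ, h1, h2⟩ := hdir ν ρ
    exact ⟨κ, fun i => ⟨h1 _, h2 _⟩⟩)
  have hμ : ∀ B, MeasurableSet B → μ B = ⨆ ν : S, ν.1 B := fun B hB =>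
    Measure.ofMeasurable_apply B hB
  have hle : sSup S ≤ μ := sSup_le fun ν hν => Measure.le_iff.2 fun B hB => by
    rw [hμ B hB]
    exact le_iSup (fun ν : S => ν.1 B) ⟨ν, hν⟩
  refine (hle A).trans ?_
  rw [hμ A hA]
  exact iSup_le fun ν => hc ν.1 ν.2

/-- A bounded superadditive interval function has a largest minorant. -/
theorem sSup_mem_intervalMinorants {F : ℝ → ℝ → ℝ≥0∞} (hF : IntervalSuperadditive F)
    {C : ℝ≥0∞} (hC : C ≠ ⊤) (hFC : ∀ a b, a ≤ b → F a b ≤ C) :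
    sSup (intervalMinorants F) ∈ intervalMinorants F := fun a b hab =>
  sSup_apply_le_of_directedOn (directedOn_intervalMinorants hF hC hFC) ⟨0, fun _ _ _ => by simp⟩
    measurableSet_Ioo fun _ hν => hν a b hab

/-! ### Densities of interval functions -/

/-- Left endpoint of the cell of the grid `ℤ / (n + 1)` that contains `t`. -/
noncomputable def cellLeft (n : ℕ) (t : ℝ) : ℝ := ⌊((n : ℝ) + 1) * t⌋ / ((n : ℝ) + 1)

/-- Right endpoint of the cell of the grid `ℤ / (n + 1)` that contains `t`. -/
noncomputable def cellRight (n : ℕ) (t : ℝ) : ℝ := (⌊((n : ℝ) + 1) * t⌋ + 1) / ((n : ℝ) + 1)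

/-- The lower density of an interval function `F` at `t`, along the cells of the grids
`ℤ / (n + 1)` that contain `t`. For bounded superadditive `F` it is the density of the absolutely
continuous part of the largest measure below `F`. -/
noncomputable def lowerDensity (F : ℝ → ℝ → ℝ≥0∞) (t : ℝ) : ℝ≥0∞ :=
  liminf (fun n : ℕ => ((n : ℝ≥0∞) + 1) * F (cellLeft n t) (cellRight n t)) atTop

theorem cellLeft_le (n : ℕ) (t : ℝ) : cellLeft n t ≤ t := by
  rw [cellLeft, div_le_iff₀ (by positivity), mul_comm]
  exact Int.floor_le _

theorem lt_cellRight (n : ℕ) (t : ℝ) : t < cellRight n t := by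
  rw [cellRight, lt_div_iff₀ (by positivity), mul_comm]
  exact Int.lt_floor_add_one _

theorem cellRight_eq (n : ℕ) (t : ℝ) : cellRight n t = cellLeft n t + 1 / ((n : ℝ) + 1) := by
  rw [cellRight, cellLeft, add_div]

theorem tendsto_cellLeft (t : ℝ) : Tendsto (fun n => cellLeft n t) atTop (𝓝 t) := by
  have h : Tendsto (fun n : ℕ => t - 1 / ((n : ℝ) + 1)) atTop (𝓝 (t - 0)) :=
    tendsto_const_nhds.sub tendsto_one_div_add_atTop_nhds_zero_nat
  rw [sub_zero] at h
  refine tendsto_of_tendsto_of_tendsto_of_le_of_le h tendsto_const_nhds (fun n => ?_)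
    fun n => cellLeft_le n t
  have := lt_cellRight n t
  rw [cellRight_eq] at this
  exact (sub_lt_iff_lt_add.2 this).le

theorem tendsto_cellRight (t : ℝ) : Tendsto (fun n => cellRight n t) atTop (𝓝 t) := by
  have h : Tendsto (fun n : ℕ => cellLeft n t + 1 / ((n : ℝ) + 1)) atTop (𝓝 (t + 0)) :=
    (tendsto_cellLeft t).add tendsto_one_div_add_atTop_nhds_zero_nat
  rw [add_zero] at h
  simpa only [cellRight_eq] using h

theorem measurable_intervalFun_cell (F : ℝ → ℝ → ℝ≥0∞) (n : ℕ) :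
    Measurable fun t => ((n : ℝ≥0∞) + 1) * F (cellLeft n t) (cellRight n t) := by
  have h : Measurable fun k : ℤ => ((n : ℝ≥0∞) + 1) *
      F ((k : ℝ) / ((n : ℝ) + 1)) (((k : ℝ) + 1) / ((n : ℝ) + 1)) := measurable_of_countable _
  exact h.comp (Int.measurable_floor.comp (measurable_const.mul measurable_id))

theorem measurable_lowerDensity (F : ℝ → ℝ → ℝ≥0∞) : Measurable (lowerDensity F) :=
  Measurable.liminf fun n => measurable_intervalFun_cell F n

/-- The lower density at `t` depends on small intervals around `t` only. -/
theorem lowerDensity_congr {F F' : ℝ → ℝ → ℝ≥0∞} {a b t : ℝ}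
    (h : ∀ c d, a < c → c ≤ d → d < b → F c d = F' c d) (ht : t ∈ Ioo a b) :
    lowerDensity F t = lowerDensity F' t := by
  refine liminf_congr ?_
  filter_upwards [(tendsto_cellLeft t).eventually (lt_mem_nhds ht.1),
    (tendsto_cellRight t).eventually (gt_mem_nhds ht.2)] with n h1 h2
  rw [h _ _ h1 ((cellLeft_le n t).trans (lt_cellRight n t).le) h2]

theorem floor_eq_of_mem_cell {n : ℕ} {k : ℤ} {t : ℝ}
    (ht : t ∈ Ico ((k : ℝ) / ((n : ℝ) + 1)) (((k : ℝ) + 1) / ((n : ℝ) + 1))) :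
    ⌊((n : ℝ) + 1) * t⌋ = k := by
  have hn : (0 : ℝ) < (n : ℝ) + 1 := by positivity
  rw [Int.floor_eq_iff]
  refine ⟨?_, ?_⟩
  · rw [mul_comm, ← div_le_iff₀ hn]; exact ht.1
  · rw [mul_comm, ← lt_div_iff₀ hn]; exact ht.2

theorem setLIntegral_intervalFun_cell_le {F : ℝ → ℝ → ℝ≥0∞} (hF : IntervalSuperadditive F)
    (n : ℕ) (k : ℤ) (j : ℕ) :
    ∫⁻ t in Ico ((k : ℝ) / ((n : ℝ) + 1)) (((k : ℝ) + j) / ((n : ℝ) + 1)),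
      ((n : ℝ≥0∞) + 1) * F (cellLeft n t) (cellRight n t) ≤
      F ((k : ℝ) / ((n : ℝ) + 1)) (((k : ℝ) + j) / ((n : ℝ) + 1)) := by
  have hn : (0 : ℝ) < (n : ℝ) + 1 := by positivity
  induction j with
  | zero => simp
  | succ j ih =>
    have h1 : (k : ℝ) / ((n : ℝ) + 1) ≤ ((k : ℝ) + j) / ((n : ℝ) + 1) := by
      gcongr; linarith [j.cast_nonneg (α := ℝ)]
    have h2 : ((k : ℝ) + j) / ((n : ℝ) + 1) ≤ ((k : ℝ) + (j + 1 : ℕ)) / ((n : ℝ) + 1) := by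
      gcongr; simp
    rw [← Ico_union_Ico_eq_Ico h1 h2]
    refine (lintegral_union_le _ _ _).trans
      ((add_le_add ih (le_of_eq ?_)).trans (hF _ _ _ h1 h2))
    have hcell : ∀ t ∈ Ico (((k : ℝ) + j) / ((n : ℝ) + 1))
        (((k : ℝ) + (j + 1 : ℕ)) / ((n : ℝ) + 1)),
        ((n : ℝ≥0∞) + 1) * F (cellLeft n t) (cellRight n t) = ((n : ℝ≥0∞) + 1) *
          F (((k : ℝ) + j) / ((n : ℝ) + 1)) (((k : ℝ) + (j + 1 : ℕ)) / ((n : ℝ) + 1)) := by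
      intro t ht
      have := floor_eq_of_mem_cell (n := n) (k := k + j) (t := t) (by
        push_cast at ht ⊢
        rwa [add_assoc])
      rw [cellLeft, cellRight, this]
      push_cast
      rw [add_assoc]
    rw [setLIntegral_congr_fun measurableSet_Ico hcell, setLIntegral_const, Real.volume_Ico]
    have : ((k : ℝ) + (j + 1 : ℕ)) / ((n : ℝ) + 1) - ((k : ℝ) + j) / ((n : ℝ) + 1) =
        ((n : ℝ) + 1)⁻¹ := by
      push_cast; field_simp; ring
    rw [this, ENNReal.ofReal_inv_of_pos hn, ENNReal.ofReal_add (by positivity) zero_le_one,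
      ENNReal.ofReal_natCast, ENNReal.ofReal_one, mul_right_comm,
      ENNReal.mul_inv_cancel (by simp) (by simp), one_mul]

/-- The lower density of a superadditive interval function integrates to at most the interval
function, by Fatou's lemma. -/
theorem setLIntegral_lowerDensity_le {F : ℝ → ℝ → ℝ≥0∞} (hF : IntervalSuperadditive F)
    (a b : ℝ) : ∫⁻ t in Ioo a b, lowerDensity F t ≤ F a b := by
  -- Only cells inside `[a, b]` are kept, which does not change the lower limit on `(a, b)`.
  let G : ℝ → ℝ → ℝ≥0∞ := fun c d => if a ≤ c ∧ d ≤ b then F c d else 0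
  have hG : ∀ t ∈ Ioo a b, lowerDensity F t = lowerDensity G t := fun t ht =>
    lowerDensity_congr (fun c d hc _ hd => by simp [G, hc.le, hd.le]) ht
  rw [setLIntegral_congr_fun measurableSet_Ioo hG]
  refine (lintegral_liminf_le fun n => measurable_intervalFun_cell G n).trans ?_
  refine liminf_le_of_frequently_le' (Frequently.of_forall fun n => ?_)
  have hn : (0 : ℝ) < (n : ℝ) + 1 := by positivity
  let k := ⌈((n : ℝ) + 1) * a⌉
  let l := ⌊((n : ℝ) + 1) * b⌋
  rcases lt_or_ge l k with hlk | hkl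
  · refine le_of_eq_of_le ?_ zero_le
    refine lintegral_eq_zero_of_ae_eq_zero (Eventually.of_forall fun t => ?_)
    simp only [G, Pi.zero_apply, mul_eq_zero, ite_eq_right_iff]
    refine Or.inr fun ⟨h1, h2⟩ => ?_
    rw [cellLeft, le_div_iff₀ hn, mul_comm] at h1
    rw [cellRight, div_le_iff₀ hn, mul_comm b] at h2
    have h1' : k ≤ ⌊((n : ℝ) + 1) * t⌋ := Int.ceil_le.2 h1
    have h2' : ⌊((n : ℝ) + 1) * t⌋ + 1 ≤ l := Int.le_floor.2 (by exact_mod_cast h2)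
    omega
  · obtain ⟨j, hj⟩ := Int.le.dest hkl
    have hlj : (l : ℝ) = (k : ℝ) + j := by exact_mod_cast hj.symm
    have hka : a ≤ (k : ℝ) / ((n : ℝ) + 1) := by
      rw [le_div_iff₀ hn, mul_comm]; exact Int.le_ceil _
    have hlb : ((k : ℝ) + j) / ((n : ℝ) + 1) ≤ b := by
      rw [← hlj, div_le_iff₀ hn, mul_comm b]; exact Int.floor_le _
    have hkl' : (k : ℝ) / ((n : ℝ) + 1) ≤ ((k : ℝ) + j) / ((n : ℝ) + 1) := by
      gcongr; linarith [j.cast_nonneg (α := ℝ)]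
    calc ∫⁻ t in Ioo a b, ((n : ℝ≥0∞) + 1) * G (cellLeft n t) (cellRight n t)
        ≤ ∫⁻ t, (Ico ((k : ℝ) / ((n : ℝ) + 1)) (((k : ℝ) + j) / ((n : ℝ) + 1))).indicator
            (fun t => ((n : ℝ≥0∞) + 1) * F (cellLeft n t) (cellRight n t)) t := by
          refine (setLIntegral_le_lintegral _ _).trans (lintegral_mono fun t => ?_)
          by_cases ht : a ≤ cellLeft n t ∧ cellRight n t ≤ b
          · have hmem : t ∈ Ico ((k : ℝ) / ((n : ℝ) + 1)) (((k : ℝ) + j) / ((n : ℝ) + 1)) := by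
              obtain ⟨h1, h2⟩ := ht
              have h1' := h1
              have h2' := h2
              rw [cellLeft, le_div_iff₀ hn, mul_comm] at h1'
              rw [cellRight, div_le_iff₀ hn, mul_comm b] at h2'
              refine ⟨le_trans ?_ (cellLeft_le n t), lt_of_lt_of_le (lt_cellRight n t) ?_⟩
              · rw [cellLeft]; gcongr; exact Int.ceil_le.2 h1'
              · have h3 : ⌊((n : ℝ) + 1) * t⌋ + 1 ≤ l := Int.le_floor.2 (by exact_mod_cast h2')
                have h4 : (⌊((n : ℝ) + 1) * t⌋ : ℝ) + 1 ≤ l := by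
                  have := (Int.cast_le (R := ℝ)).2 h3
                  rwa [Int.cast_add, Int.cast_one] at this
                rw [cellRight, ← hlj]; gcongr
            rw [indicator_of_mem hmem]
            simp [G, ht]
          · simp [G, ht]
      _ = ∫⁻ t in Ico ((k : ℝ) / ((n : ℝ) + 1)) (((k : ℝ) + j) / ((n : ℝ) + 1)),
            ((n : ℝ≥0∞) + 1) * F (cellLeft n t) (cellRight n t) :=
          lintegral_indicator measurableSet_Ico _
      _ ≤ F ((k : ℝ) / ((n : ℝ) + 1)) (((k : ℝ) + j) / ((n : ℝ) + 1)) :=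
          setLIntegral_intervalFun_cell_le hF n k j
      _ ≤ F a b := hF.mono hka hkl' hlb

/-- A function whose integral over every grid cell is at most `F` lies below the lower density of
`F`, by Lebesgue's differentiation theorem. -/
theorem ae_le_lowerDensity {F : ℝ → ℝ → ℝ≥0∞} {h : ℝ → ℝ≥0∞} (hh : AEMeasurable h)
    (hfin : ∫⁻ t, h t ≠ ⊤)
    (hle : ∀ (n : ℕ) (k : ℤ),
      ∫⁻ t in Ioo ((k : ℝ) / ((n : ℝ) + 1)) (((k : ℝ) + 1) / ((n : ℝ) + 1)), h t ≤
        F ((k : ℝ) / ((n : ℝ) + 1)) (((k : ℝ) + 1) / ((n : ℝ) + 1))) :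
    ∀ᵐ t, h t ≤ lowerDensity F t := by
  filter_upwards [VitaliFamily.ae_tendsto_lintegral_div
    (IsUnifLocDoublingMeasure.vitaliFamily (volume : Measure ℝ) 1) hh hfin] with t ht
  let w : ℕ → ℝ := fun n => (cellLeft n t + cellRight n t) / 2
  let δ : ℕ → ℝ := fun n => 1 / ((n : ℝ) + 1) / 2
  have hball : ∀ n, Metric.closedBall (w n) (δ n) = Icc (cellLeft n t) (cellRight n t) := by
    intro n
    rw [Real.closedBall_eq_Icc]
    simp only [w, δ, cellRight_eq]
    congr 1 <;> ring
  have hδ : Tendsto δ atTop (𝓝[>] 0) := by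
    refine tendsto_nhdsWithin_iff.2 ⟨?_, Eventually.of_forall fun n => ?_⟩
    · simpa [δ] using (tendsto_one_div_add_atTop_nhds_zero_nat (𝕜 := ℝ)).div_const 2
    · simp only [δ, mem_Ioi]; positivity
  have hlim := ht.comp (IsUnifLocDoublingMeasure.tendsto_closedBall_filterAt (volume : Measure ℝ)
    (K := 1) (x := t) w δ hδ (Eventually.of_forall fun n => by
      rw [one_mul, hball]
      exact ⟨cellLeft_le n t, (lt_cellRight n t).le⟩))
  rw [← hlim.liminf_eq]
  refine liminf_le_liminf (Eventually.of_forall fun n => ?_)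
  have hn : (0 : ℝ) < (n : ℝ) + 1 := by positivity
  have hvol : volume (Icc (cellLeft n t) (cellRight n t)) = ((n : ℝ≥0∞) + 1)⁻¹ := by
    rw [Real.volume_Icc, cellRight_eq, add_sub_cancel_left, one_div, ENNReal.ofReal_inv_of_pos hn,
      ENNReal.ofReal_add (by positivity) zero_le_one, ENNReal.ofReal_natCast, ENNReal.ofReal_one]
  simp only [Function.comp_apply, hball]
  rw [hvol, ENNReal.div_eq_inv_mul, inv_inv, ← setLIntegral_congr Ioo_ae_eq_Icc]
  gcongr
  exact hle n ⌊((n : ℝ) + 1) * t⌋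

/-- The density of the absolutely continuous part of the largest minorant of a bounded
superadditive interval function is the lower density of the interval function. -/
theorem rnDeriv_sSup_intervalMinorants {F : ℝ → ℝ → ℝ≥0∞} (hF : IntervalSuperadditive F)
    {C : ℝ≥0∞} (hC : C ≠ ⊤) (hFC : ∀ a b, a ≤ b → F a b ≤ C) :
    (sSup (intervalMinorants F)).rnDeriv volume =ᵐ[volume] lowerDensity F := by
  set ν := sSup (intervalMinorants F)
  have hν : ν ∈ intervalMinorants F := sSup_mem_intervalMinorants hF hC hFC
  have := isFiniteMeasure_of_mem_intervalMinorants hC hFC hν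
  have hD : volume.withDensity (lowerDensity F) ∈ intervalMinorants F := fun a b _ => by
    rw [withDensity_apply _ measurableSet_Ioo]
    exact setLIntegral_lowerDensity_le hF a b
  have := isFiniteMeasure_of_mem_intervalMinorants hC hFC hD
  have hle : volume.withDensity (lowerDensity F) ≤ ν := le_sSup hD
  have h1 : lowerDensity F ≤ᵐ[volume] ν.rnDeriv volume := by
    have hadd := Measure.rnDeriv_add (ν - volume.withDensity (lowerDensity F))
      (volume.withDensity (lowerDensity F)) volume
    rw [Measure.sub_add_cancel_of_le hle] at hadd
    filter_upwards [hadd, Measure.rnDeriv_withDensity volume (measurable_lowerDensity F)]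
      with t ht ht'
    rw [ht, Pi.add_apply, ht']
    exact le_add_self
  have h2 : ν.rnDeriv volume ≤ᵐ[volume] lowerDensity F := by
    refine ae_le_lowerDensity (Measure.measurable_rnDeriv _ _).aemeasurable
      (Measure.lintegral_rnDeriv_lt_top _ _).ne fun n k => ?_
    exact (Measure.setLIntegral_rnDeriv_le _).trans (hν _ _ (by gcongr; linarith))
  exact h2.antisymm h1

/-! ### Order and topology of spacetimes -/

theorem IsRoughSpacetime.add_le {M : Type*} {ℓ : M → M → EReal} (hℓ : IsRoughSpacetime ℓ)
    (x y z : M) : ℓ x y + ℓ y z ≤ ℓ x z :=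
  le_extDiff_iff.1 (hℓ.reverse_triangle x y z)

theorem IsRoughSpacetime.causal_trans {M : Type*} {ℓ : M → M → EReal} (hℓ : IsRoughSpacetime ℓ)
    {x y z : M} (hxy : 0 ≤ ℓ x y) (hyz : 0 ≤ ℓ y z) : 0 ≤ ℓ x z :=
  (add_nonneg hxy hyz).trans (hℓ.add_le x y z)

theorem IsRoughSpacetime.le_of_causal_right {M : Type*} {ℓ : M → M → EReal}
    (hℓ : IsRoughSpacetime ℓ) (p : M) {y z : M} (hyz : 0 ≤ ℓ y z) : ℓ p y ≤ ℓ p z :=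
  (le_add_of_nonneg_right hyz).trans (hℓ.add_le p y z)

theorem IsRoughSpacetime.le_of_causal_left {M : Type*} {ℓ : M → M → EReal}
    (hℓ : IsRoughSpacetime ℓ) (p : M) {x y : M} (hxy : 0 ≤ ℓ x y) : ℓ y p ≤ ℓ x p :=
  (le_add_of_nonneg_left hxy).trans (hℓ.add_le x y p)

theorem IsForwardMetricSpacetime.tendsto_nhds_iff {M ι : Type*} [t : TopologicalSpace M]
    {ℓ : M → M → EReal} (hℓ : IsForwardMetricSpacetime ℓ) {c : ι → M} {l : Filter ι} {y : M} :
    Tendsto c l (𝓝 y) ↔ (∀ p, 0 < ℓ p y → ∀ᶠ i in l, 0 < ℓ p (c i)) ∧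
      ∀ q, 0 < ℓ y q → ∀ᶠ i in l, 0 < ℓ (c i) q := by
  have h := hℓ.topology_eq
  subst h
  rw [TopologicalSpace.tendsto_nhds_generateFrom_iff]
  constructor
  · intro h
    exact ⟨fun p hp => h _ (Or.inl ⟨p, rfl⟩) hp, fun q hq => h _ (Or.inr ⟨q, rfl⟩) hq⟩
  · rintro ⟨h1, h2⟩ s (⟨p, rfl⟩ | ⟨q, rfl⟩) hs
    · exact h1 p hs
    · exact h2 q hs

/-- The causal relation of a forward metric spacetime is antisymmetric: causally equivalent points
have the same chronological future and past, so the (Hausdorff) chronological topology does not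
separate them. -/
theorem IsForwardMetricSpacetime.causal_antisymm {M : Type*} [TopologicalSpace M]
    {ℓ : M → M → EReal} (hℓ : IsForwardMetricSpacetime ℓ) {x y : M} (hxy : 0 ≤ ℓ x y)
    (hyx : 0 ≤ ℓ y x) : x = y := by
  have := hℓ.polish
  have h : Tendsto (fun _ : ℕ => x) atTop (𝓝 y) := hℓ.tendsto_nhds_iff.2
    ⟨fun p hp => Eventually.of_forall fun _ => hp.trans_le (hℓ.le_of_causal_right p hyx),
      fun q hq => Eventually.of_forall fun _ => hq.trans_le (hℓ.le_of_causal_left q hxy)⟩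
  exact tendsto_nhds_unique tendsto_const_nhds h

theorem IsForwardMetricSpacetime.causal_of_tendsto {M ι : Type*} [TopologicalSpace M]
    {ℓ : M → M → EReal} (hℓ : IsForwardMetricSpacetime ℓ) {l : Filter ι} [l.NeBot] {c d : ι → M}
    {x y : M} (hc : Tendsto c l (𝓝 x)) (hd : Tendsto d l (𝓝 y))
    (h : ∀ᶠ i in l, 0 ≤ ℓ (c i) (d i)) : 0 ≤ ℓ x y :=
  hℓ.isClosed_causal.mem_of_tendsto (hc.prodMk_nhds hd) h

theorem measurable_toENNReal_of_upperSemicontinuous {M : Type*} [TopologicalSpace M]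
    [MeasurableSpace M] [BorelSpace M] [PolishSpace M] {ℓ : M → M → EReal}
    (husc : UpperSemicontinuous fun p : M × M => max (ℓ p.1 p.2) 0) :
    Measurable fun p : M × M => (ℓ p.1 p.2).toENNReal := by
  have h : (fun p : M × M => (ℓ p.1 p.2).toENNReal) =
      fun p : M × M => (max (ℓ p.1 p.2) 0).toENNReal := by
    ext p
    rcases le_total (ℓ p.1 p.2) 0 with h | h
    · rw [max_eq_right h, EReal.toENNReal_of_nonpos h, EReal.toENNReal_zero]
    · rw [max_eq_left h]
  rw [h]
  exact husc.measurable.ereal_toENNReal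

theorem toENNReal_separation_ne_top {M : Type*} {ℓ : M → M → EReal}
    (hfin : ∀ x y, max (ℓ x y) 0 < ⊤) (x y : M) :
    (ℓ x y).toENNReal ≠ ⊤ := by
  rw [EReal.toENNReal_ne_top_iff]
  exact ((le_max_left _ _).trans_lt (hfin x y)).ne

/-! ### Causal paths -/

namespace LCC

variable {M : Type*} [TopologicalSpace M] {ℓ : M → M → EReal}

/-- The extension of a path to `ℝ`, constant on both sides of `[0, 1]`. -/
noncomputable def extend (γ : LCC ℓ) (t : ℝ) : M := γ (projIcc 0 1 zero_le_one t)

theorem extend_coe (γ : LCC ℓ) (t : unitInterval) : γ.extend t = γ t := by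
  rw [extend, projIcc_val]

theorem causal_extend (γ : LCC ℓ) {a b : ℝ} (hab : a ≤ b) : 0 ≤ ℓ (γ.extend a) (γ.extend b) :=
  γ.causal' _ _ (monotone_projIcc zero_le_one hab)

/-- The time separation along a path, as an interval function. -/
noncomputable def separation (γ : LCC ℓ) (a b : ℝ) : ℝ≥0∞ :=
  (ℓ (γ.extend a) (γ.extend b)).toENNReal

/-- The increments of `f` along a path, as an interval function. -/
noncomputable def increment (f : M → EReal) (γ : LCC ℓ) (a b : ℝ) : ℝ≥0∞ :=
  (extDiff (f (γ.extend b)) (f (γ.extend a))).toENNReal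

theorem intervalSuperadditive_separation (hℓ : IsRoughSpacetime ℓ) (γ : LCC ℓ) :
    IntervalSuperadditive γ.separation := fun a b c hab hbc => by
  rw [separation, separation, separation,
    ← EReal.toENNReal_add (γ.causal_extend hab) (γ.causal_extend hbc)]
  exact EReal.toENNReal_le_toENNReal (hℓ.add_le _ _ _)

theorem separation_le (hℓ : IsRoughSpacetime ℓ) (γ : LCC ℓ) (a b : ℝ) :
    γ.separation a b ≤ (ℓ (γ 0) (γ 1)).toENNReal := by
  refine EReal.toENNReal_le_toENNReal ?_
  exact (hℓ.le_of_causal_right _ (γ.causal' _ 1 unitInterval.le_one')).trans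
    (hℓ.le_of_causal_left _ (γ.causal' 0 _ unitInterval.nonneg'))

theorem causalSpeedMeasure_eq (γ : LCC ℓ) :
    causalSpeedMeasure γ = sSup (intervalMinorants γ.separation) := rfl

/-- The causal speed is the lower density of the time separation along the path. This expression
is jointly measurable in the path and the time. -/
theorem causalSpeed_ae_eq (hℓ : IsRoughSpacetime ℓ) (hfin : ∀ x y, max (ℓ x y) 0 < ⊤) (γ : LCC ℓ) :
    causalSpeed γ =ᵐ[volume] lowerDensity γ.separation :=
  rnDeriv_sSup_intervalMinorants (γ.intervalSuperadditive_separation hℓ)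
    (toENNReal_separation_ne_top hfin _ _) fun a b _ => γ.separation_le hℓ a b

theorem lintegral_causalSpeed_le (hℓ : IsRoughSpacetime ℓ) (hfin : ∀ x y, max (ℓ x y) 0 < ⊤)
    (γ : LCC ℓ) : ∫⁻ t in Icc (0 : ℝ) 1, causalSpeed γ t ≤ (ℓ (γ 0) (γ 1)).toENNReal := by
  rw [lintegral_congr_ae (ae_restrict_of_ae (γ.causalSpeed_ae_eq hℓ hfin)),
    ← setLIntegral_congr Ioo_ae_eq_Icc]
  exact (setLIntegral_lowerDensity_le (γ.intervalSuperadditive_separation hℓ) 0 1).trans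
    (γ.separation_le hℓ 0 1)

theorem tendsto_nhdsLE (γ : LCC ℓ) (t : unitInterval) : Tendsto γ (𝓝[≤] t) (𝓝 (γ t)) := by
  rw [← Iio_insert, nhdsWithin_insert]
  refine Tendsto.sup (tendsto_pure_left.2 fun s hs => mem_of_mem_nhds hs) ?_
  rcases eq_or_ne t 0 with rfl | ht
  · have : Iio (0 : unitInterval) = ∅ := by
      ext s; simp
    rw [this, nhdsWithin_empty]
    exact tendsto_bot
  · exact γ.left_continuous' t (unitInterval.pos_iff_ne_zero.2 ht)

/-- For `a ≤ b`, the path that stays at `γ a` before the time `a` and at `γ b` after the time `b`.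
Freezing replaces the restriction of `γ` to `[a, b]` and needs no reparametrization. -/
noncomputable def freeze (γ : LCC ℓ) (a b : unitInterval) : LCC ℓ where
  toFun r := γ (max a (min b r))
  causal' s t hst := γ.causal' _ _ (by gcongr)
  left_continuous' t _ := by
    have hc : Continuous fun r : unitInterval => max a (min b r) := by fun_prop
    refine (γ.tendsto_nhdsLE _).comp (tendsto_nhdsWithin_iff.2
      ⟨(hc.tendsto t).mono_left nhdsWithin_le_nhds, ?_⟩)
    filter_upwards [self_mem_nhdsWithin] with r hr
    have hr : r ≤ t := le_of_lt hr
    simp only [mem_Iic]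
    gcongr

theorem freeze_apply (γ : LCC ℓ) (a b r : unitInterval) : γ.freeze a b r = γ (max a (min b r)) :=
  rfl

theorem freeze_extend_of_mem (γ : LCC ℓ) {a b : unitInterval} {t : ℝ}
    (ht : t ∈ Icc (a : ℝ) b) : (γ.freeze a b).extend t = γ.extend t := by
  have h01 : t ∈ Icc (0 : ℝ) 1 := ⟨a.2.1.trans ht.1, ht.2.trans b.2.2⟩
  lift t to unitInterval using h01
  have h1 : min b t = t := min_eq_right (Subtype.coe_le_coe.1 ht.2)
  have h2 : max a t = t := max_eq_right (Subtype.coe_le_coe.1 ht.1)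
  rw [extend_coe, extend_coe, freeze_apply, h1, h2]

theorem causalSpeed_freeze (hℓ : IsRoughSpacetime ℓ) (hfin : ∀ x y, max (ℓ x y) 0 < ⊤) (γ : LCC ℓ)
    (a b : unitInterval) :
    ∀ᵐ t : ℝ, t ∈ Ioo (a : ℝ) b → causalSpeed (γ.freeze a b) t = causalSpeed γ t := by
  filter_upwards [γ.causalSpeed_ae_eq hℓ hfin, (γ.freeze a b).causalSpeed_ae_eq hℓ hfin]
    with t h1 h2 ht
  rw [h1, h2]
  refine lowerDensity_congr (fun c d hac hcd hdb => ?_) ht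
  rw [separation, separation, freeze_extend_of_mem γ ⟨hac.le, hcd.trans hdb.le⟩,
    freeze_extend_of_mem γ ⟨hac.le.trans hcd, hdb.le⟩]

/-- Times of the grid `ℤ / (n + 1)`, cut off to `[0, 1]`. -/
noncomputable def gridTime (n : ℕ) (k : ℤ) : unitInterval :=
  projIcc 0 1 zero_le_one (((k : ℝ) - 1) / ((n : ℝ) + 1))

/-- A path is determined by its values at grid times, through left-continuity. -/
theorem tendsto_gridTime (γ : LCC ℓ) (t : unitInterval) :
    Tendsto (fun n : ℕ => γ (gridTime n ⌈((n : ℝ) + 1) * t⌉)) atTop (𝓝 (γ t)) := by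
  have hle : ∀ n : ℕ, (((⌈((n : ℝ) + 1) * t⌉ : ℤ) : ℝ) - 1) / ((n : ℝ) + 1) ≤ t := by
    intro n
    rw [div_le_iff₀ (by positivity)]
    linarith [Int.ceil_lt_add_one (((n : ℝ) + 1) * t)]
  have hge : ∀ n : ℕ, (t : ℝ) - 1 / ((n : ℝ) + 1) ≤
      (((⌈((n : ℝ) + 1) * t⌉ : ℤ) : ℝ) - 1) / ((n : ℝ) + 1) := by
    intro n
    rw [sub_div, sub_le_sub_iff_right, le_div_iff₀ (by positivity), mul_comm]
    exact Int.le_ceil _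
  have hlim : Tendsto (fun n : ℕ => (((⌈((n : ℝ) + 1) * t⌉ : ℤ) : ℝ) - 1) / ((n : ℝ) + 1)) atTop
      (𝓝 (t : ℝ)) := by
    have h : Tendsto (fun n : ℕ => (t : ℝ) - 1 / ((n : ℝ) + 1)) atTop (𝓝 (t - 0)) :=
      tendsto_const_nhds.sub tendsto_one_div_add_atTop_nhds_zero_nat
    rw [sub_zero] at h
    exact tendsto_of_tendsto_of_tendsto_of_le_of_le h tendsto_const_nhds hge hle
  refine (γ.tendsto_nhdsLE t).comp (tendsto_nhdsWithin_iff.2 ⟨?_, Eventually.of_forall fun n => ?_⟩)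
  · have := (continuous_projIcc (h := zero_le_one' ℝ)).continuousAt.tendsto.comp hlim
    rwa [projIcc_val] at this
  · have := monotone_projIcc (zero_le_one' ℝ) (hle n)
    rwa [projIcc_val] at this

theorem mem_of_forall_gridTime {A : Set M} (hA : IsClosed A) {γ : LCC ℓ}
    (h : ∀ n k, γ (gridTime n k) ∈ A) (t : unitInterval) : γ t ∈ A :=
  hA.mem_of_tendsto (γ.tendsto_gridTime t) (Eventually.of_forall fun _ => h _ _)

variable [MeasurableSpace M]

theorem measurable_eval (t : unitInterval) : Measurable fun γ : LCC ℓ => γ t :=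
  (measurable_pi_apply t).comp (comap_measurable LCC.toFun)

theorem measurable_of_eval {Ω : Type*} [MeasurableSpace Ω] {Φ : Ω → LCC ℓ}
    (h : ∀ t, Measurable fun ω => Φ ω t) : Measurable Φ := by
  rw [measurable_iff_comap_le]
  change MeasurableSpace.comap Φ (MeasurableSpace.comap LCC.toFun MeasurableSpace.pi) ≤ _
  rw [MeasurableSpace.comap_comp]
  exact measurable_iff_comap_le.1 (measurable_pi_lambda (LCC.toFun ∘ Φ) h)

theorem measurable_freeze (a b : unitInterval) : Measurable fun γ : LCC ℓ => γ.freeze a b :=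
  measurable_of_eval fun _ => measurable_eval _

theorem measurableSet_forall_mem [OpensMeasurableSpace M] {A : Set M} (hA : IsClosed A) :
    MeasurableSet {γ : LCC ℓ | ∀ t, γ t ∈ A} := by
  have : {γ : LCC ℓ | ∀ t, γ t ∈ A} = ⋂ (n : ℕ) (k : ℤ), {γ : LCC ℓ | γ (gridTime n k) ∈ A} := by
    ext γ
    simp only [mem_ofPred_eq, mem_iInter]
    exact ⟨fun h n k => h _, fun h => mem_of_forall_gridTime hA h⟩
  rw [this]
  exact MeasurableSet.iInter fun n => MeasurableSet.iInter fun k =>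
    measurable_eval _ hA.measurableSet

/-- Joint measurability of the evaluation. -/
theorem measurable_extend [BorelSpace M] [PolishSpace M] :
    Measurable fun p : LCC ℓ × ℝ => p.1.extend p.2 := by
  have h : ∀ n : ℕ, Measurable fun p : LCC ℓ × unitInterval =>
      p.1 (gridTime n ⌈((n : ℝ) + 1) * p.2⌉) := by
    intro n
    have h1 : Measurable fun p : LCC ℓ × ℤ => p.1 (gridTime n p.2) :=
      measurable_from_prod_countable_left fun k => measurable_eval (gridTime n k)
    exact h1.comp (measurable_fst.prodMk (Int.measurable_ceil.comp
      (measurable_const.mul (measurable_subtype_coe.comp measurable_snd))))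
  have h2 : Measurable fun p : LCC ℓ × unitInterval => p.1 p.2 :=
    measurable_of_tendsto_metrizable h
      (tendsto_pi_nhds.2 fun p => p.1.tendsto_gridTime p.2)
  exact h2.comp (measurable_fst.prodMk ((continuous_projIcc (h := zero_le_one' ℝ)).measurable.comp
    measurable_snd))

theorem measurable_lowerDensity_separation [BorelSpace M] [PolishSpace M]
    (husc : UpperSemicontinuous fun p : M × M => max (ℓ p.1 p.2) 0) :
    Measurable fun p : LCC ℓ × ℝ => lowerDensity p.1.separation p.2 := by
  refine Measurable.liminf fun n => Measurable.const_mul ?_ _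
  have h1 : Measurable fun p : LCC ℓ × ℤ => p.1.separation ((p.2 : ℝ) / ((n : ℝ) + 1))
      (((p.2 : ℝ) + 1) / ((n : ℝ) + 1)) :=
    measurable_from_prod_countable_left fun k =>
      (measurable_toENNReal_of_upperSemicontinuous husc).comp
        ((measurable_eval (projIcc 0 1 zero_le_one ((k : ℝ) / ((n : ℝ) + 1)))).prodMk
          (measurable_eval (projIcc 0 1 zero_le_one (((k : ℝ) + 1) / ((n : ℝ) + 1)))))
  exact h1.comp (measurable_fst.prodMk
    (Int.measurable_floor.comp (measurable_const.mul measurable_snd)))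

end LCC

theorem intervalSuperadditive_increment {M : Type*} [TopologicalSpace M] {ℓ : M → M → EReal}
    {f : M → EReal} (hf : ∀ x y, 0 ≤ ℓ x y → f x ≤ f y) (γ : LCC ℓ) :
    IntervalSuperadditive (LCC.increment f γ) := by
  intro a b c hab hbc
  have h1 := hf _ _ (γ.causal_extend hab)
  have h2 := hf _ _ (γ.causal_extend hbc)
  simp only [LCC.increment]
  generalize f (γ.extend a) = x at *
  generalize f (γ.extend b) = y at *
  generalize f (γ.extend c) = z at *
  rcases eq_or_ne x ⊥ with rfl | hx
  · simp [extDiff]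
  rcases eq_or_ne z ⊤ with rfl | hz
  · simp [extDiff]
  have hy : y ≠ ⊥ := fun h => hx (le_bot_iff.1 (h ▸ h1))
  have hy' : y ≠ ⊤ := fun h => hz (top_le_iff.1 (h ▸ h2))
  lift y to ℝ using ⟨hy', hy⟩
  lift x to ℝ using ⟨ne_top_of_le_ne_top hy' h1, hx⟩
  lift z to ℝ using ⟨hz, ne_bot_of_le_ne_bot hy h2⟩
  have key : ∀ u v : ℝ, (extDiff (u : EReal) v).toENNReal = ENNReal.ofReal (u - v) := by
    intro u v
    rw [extDiff, ← EReal.coe_sub, ← EReal.coe_neg,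
      EReal.toENNReal_of_ne_top (EReal.coe_ne_top _), EReal.toReal_coe, neg_sub]
  rw [key, key, key, ← ENNReal.ofReal_add (sub_nonneg.2 (EReal.coe_le_coe_iff.1 h1))
    (sub_nonneg.2 (EReal.coe_le_coe_iff.1 h2))]
  exact ENNReal.ofReal_le_ofReal (by linarith)

/-! ### Test plans -/

section TestPlan

variable {M : Type*} [TopologicalSpace M] [MeasurableSpace M] {ℓ : M → M → EReal} {m : Measure M}
  {π : Measure (LCC ℓ)}

theorem IsTestPlan.ae_eval (hπ : IsTestPlan m π) (t : unitInterval) {P : M → Prop}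
    (hP : ∀ᵐ x ∂m, P x) : ∀ᵐ γ ∂π, P (γ t) := by
  obtain ⟨C, -, hC⟩ := hπ.bounded_compression
  have hac : π.map (fun γ : LCC ℓ => γ t) ≪ m := Measure.absolutelyContinuous_of_le_smul (hC t)
  exact ae_of_ae_map (LCC.measurable_eval t).aemeasurable (hac hP)

theorem IsTestPlan.ae_forall_mem (hπ : IsTestPlan m π) {A : Set M} (hA : IsClosed A)
    (hm : ∀ᵐ x ∂m, x ∈ A) : ∀ᵐ γ ∂π, ∀ t, γ t ∈ A := by
  have : ∀ᵐ γ ∂π, ∀ (n : ℕ) (k : ℤ), γ (LCC.gridTime n k) ∈ A :=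
    ae_all_iff.2 fun n => ae_all_iff.2 fun k => hπ.ae_eval _ hm
  filter_upwards [this] with γ hγ
  exact LCC.mem_of_forall_gridTime hA hγ

/-- Almost every path of a test plan spends almost no time in a given null set. -/
theorem IsTestPlan.ae_ae_extend [BorelSpace M] [PolishSpace M] (hπ : IsTestPlan m π)
    {P : M → Prop} (hP : ∀ᵐ x ∂m, P x) : ∀ᵐ γ ∂π, ∀ᵐ t : ℝ, P (γ.extend t) := by
  have := hπ.isProbabilityMeasure
  obtain ⟨N, hN, hNm, hN0⟩ := exists_measurable_superset_of_null (show m {x | ¬ P x} = 0 from hP)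
  have hmeas : MeasurableSet {p : LCC ℓ × ℝ | p.1.extend p.2 ∉ N} :=
    LCC.measurable_extend hNm.compl
  have h : ∀ᵐ γ ∂π, ∀ᵐ t : ℝ, γ.extend t ∉ N := by
    rw [Measure.ae_ae_comm hmeas]
    exact Eventually.of_forall fun t => hπ.ae_eval _ (compl_mem_ae_iff.2 hN0)
  filter_upwards [h] with γ hγ
  filter_upwards [hγ] with t ht
  by_contra hc
  exact ht (hN hc)

theorem IsTestPlan.aemeasurable_lintegral [BorelSpace M] [PolishSpace M]
    (hπ : IsTestPlan m π) (hℓ : IsRoughSpacetime ℓ) (hfin : ∀ x y, max (ℓ x y) 0 < ⊤)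
    (husc : UpperSemicontinuous fun p : M × M => max (ℓ p.1 p.2) 0) {G : M → ℝ≥0∞}
    (hG : AEMeasurable G m) (A : Set ℝ) :
    AEMeasurable (fun γ : LCC ℓ => ∫⁻ t in A, G (γ.extend t) * causalSpeed γ t) π := by
  have hmeas : Measurable fun p : LCC ℓ × ℝ =>
      hG.mk G (p.1.extend p.2) * lowerDensity p.1.separation p.2 :=
    (hG.measurable_mk.comp LCC.measurable_extend).mul
      (LCC.measurable_lowerDensity_separation husc)
  refine ⟨_, Measurable.lintegral_prod_right' (ν := volume.restrict A) hmeas, ?_⟩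
  filter_upwards [hπ.ae_ae_extend hG.ae_eq_mk] with γ hγ
  refine lintegral_congr_ae (ae_restrict_of_ae ?_)
  filter_upwards [hγ, γ.causalSpeed_ae_eq hℓ hfin] with t h1 h2
  rw [h1, h2]

/-- Conditioning a test plan on a set of paths and freezing its paths yields a test plan. -/
theorem IsTestPlan.map_freeze_cond (hπ : IsTestPlan m π) {E : Set (LCC ℓ)}
    (hE : π E ≠ 0) (a b : unitInterval) :
    IsTestPlan m ((ProbabilityTheory.cond π E).map fun γ => γ.freeze a b) := by
  have := hπ.isProbabilityMeasure
  have := ProbabilityTheory.cond_isProbabilityMeasure hE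
  refine ⟨Measure.isProbabilityMeasure_map (LCC.measurable_freeze a b).aemeasurable, ?_⟩
  obtain ⟨C, hC0, hC⟩ := hπ.bounded_compression
  have hinv : (π E)⁻¹ ≠ ⊤ := ENNReal.inv_ne_top.2 hE
  refine ⟨(π E)⁻¹.toNNReal * C, mul_pos
    (ENNReal.toNNReal_pos (ENNReal.inv_ne_zero.2 (measure_ne_top π E)) hinv) hC0, fun t => ?_⟩
  rw [Measure.map_map (LCC.measurable_eval t) (LCC.measurable_freeze a b), ENNReal.coe_mul,
    ENNReal.coe_toNNReal hinv, mul_smul, ProbabilityTheory.cond]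
  have : (fun γ : LCC ℓ => γ t) ∘ (fun γ : LCC ℓ => γ.freeze a b) =
      fun γ : LCC ℓ => γ (max a (min b t)) := rfl
  rw [this, Measure.map_smul]
  gcongr
  exact (Measure.map_mono Measure.restrict_le_self (LCC.measurable_eval _)).trans (hC _)

end TestPlan

/-! ### Locality of weak subslopes and existence of a maximal one -/

section Subslope

variable {M : Type*} [TopologicalSpace M] {ℓ : M → M → EReal}

theorem lintegral_unitInterval_mul_causalSpeed (G : M → ℝ≥0∞) (γ : LCC ℓ) :
    ∫⁻ t : unitInterval, G (γ t) * causalSpeed γ (t : ℝ) =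
      ∫⁻ t in Icc (0 : ℝ) 1, G (γ.extend t) * causalSpeed γ t := by
  rw [← lintegral_subtype_comap measurableSet_Icc]
  simp only [LCC.extend_coe]
  rfl

theorem LCC.increment_zero_one (f : M → EReal) (γ : LCC ℓ) :
    LCC.increment f γ 0 1 = (extDiff (f (γ 1)) (f (γ 0))).toENNReal := by
  have h0 : γ.extend 0 = γ 0 := γ.extend_coe 0
  have h1 : γ.extend 1 = γ 1 := γ.extend_coe 1
  rw [LCC.increment, h0, h1]

variable [MeasurableSpace M] {m : Measure M}

theorem IsWeakSubslope.lintegral_le {f : M → EReal} {G : M → ℝ≥0∞}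
    (hG : IsWeakSubslope ℓ m f G) {π : Measure (LCC ℓ)} (hπ : IsTestPlan m π) :
    ∫⁻ γ, (∫⁻ t in Icc (0 : ℝ) 1, G (γ.extend t) * causalSpeed γ t) ∂π ≤
      ∫⁻ γ, (extDiff (f (γ 1)) (f (γ 0))).toENNReal ∂π := by
  simpa only [lintegral_unitInterval_mul_causalSpeed] using hG.2 π hπ

variable [BorelSpace M] [PolishSpace M]

/-- The inequality that defines weak subslopes localizes to time intervals and to almost every
path: test it with the paths of a set `E`, frozen outside of the time interval. -/
theorem IsWeakSubslope.ae_setLIntegral_le (hℓ : IsRoughSpacetime ℓ)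
    (hfin : ∀ x y, max (ℓ x y) 0 < ⊤)
    (husc : UpperSemicontinuous fun p : M × M => max (ℓ p.1 p.2) 0) {f : M → EReal} {G : M → ℝ≥0∞}
    (hG : IsWeakSubslope ℓ m f G) {π : Measure (LCC ℓ)} (hπ : IsTestPlan m π) {a b : unitInterval}
    (hab : a ≤ b) :
    ∀ᵐ γ ∂π, ∫⁻ t in Icc (a : ℝ) b, G (γ.extend t) * causalSpeed γ t ≤
      (extDiff (f (γ b)) (f (γ a))).toENNReal := by
  have := hπ.isProbabilityMeasure
  refine ae_le_of_forall_setLIntegral_le_of_sigmaFinite₀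
    (hπ.aemeasurable_lintegral hℓ hfin husc hG.1 _) fun E _ _ => ?_
  rcases eq_or_ne (π E) 0 with hE | hE
  · rw [Measure.restrict_eq_zero.2 hE]; simp
  have hπ' := hπ.map_freeze_cond hE a b
  have h1 := hG.lintegral_le hπ'
  rw [lintegral_map' (hπ'.aemeasurable_lintegral hℓ hfin husc hG.1 _)
    (LCC.measurable_freeze a b).aemeasurable] at h1
  have h2 := h1.trans (lintegral_map_le _ _)
  rw [ProbabilityTheory.cond, lintegral_smul_measure, lintegral_smul_measure, smul_eq_mul,
    smul_eq_mul, ENNReal.mul_le_mul_iff_right (ENNReal.inv_ne_zero.2 (measure_ne_top π E))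
      (ENNReal.inv_ne_top.2 hE)] at h2
  calc ∫⁻ γ in E, (∫⁻ t in Icc (a : ℝ) b, G (γ.extend t) * causalSpeed γ t) ∂π
      ≤ ∫⁻ γ in E, (∫⁻ t in Icc (0 : ℝ) 1,
          G ((γ.freeze a b).extend t) * causalSpeed (γ.freeze a b) t) ∂π := by
        refine lintegral_mono fun γ => ?_
        rw [← setLIntegral_congr Ioo_ae_eq_Icc]
        have hcongr : ∫⁻ t in Ioo (a : ℝ) b, G (γ.extend t) * causalSpeed γ t =
            ∫⁻ t in Ioo (a : ℝ) b,
              G ((γ.freeze a b).extend t) * causalSpeed (γ.freeze a b) t := by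
          refine setLIntegral_congr_fun_ae measurableSet_Ioo ?_
          filter_upwards [γ.causalSpeed_freeze hℓ hfin a b] with t ht hmem
          rw [ht hmem, γ.freeze_extend_of_mem ⟨hmem.1.le, hmem.2.le⟩]
        rw [hcongr]
        exact lintegral_mono_set (Ioo_subset_Icc_self.trans (Icc_subset_Icc a.2.1 b.2.2))
    _ ≤ ∫⁻ γ in E, (extDiff (f (γ.freeze a b 1)) (f (γ.freeze a b 0))).toENNReal ∂π := h2
    _ = ∫⁻ γ in E, (extDiff (f (γ b)) (f (γ a))).toENNReal ∂π := by
        have hb : max a (min b 1) = b := by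
          rw [min_eq_left unitInterval.le_one', max_eq_right hab]
        have ha : max a (min b 0) = a := by
          rw [min_eq_right unitInterval.nonneg', max_eq_left unitInterval.nonneg']
        simp only [LCC.freeze_apply, hb, ha]

/-- Weak subslopes of causal functions are described by a pointwise inequality along almost every
path. This makes countable suprema of weak subslopes weak subslopes. -/
theorem isWeakSubslope_iff_ae (hℓ : IsRoughSpacetime ℓ)
    (hfin : ∀ x y, max (ℓ x y) 0 < ⊤)
    (husc : UpperSemicontinuous fun p : M × M => max (ℓ p.1 p.2) 0) {f : M → EReal}
    (hf : ∀ x y, 0 ≤ ℓ x y → f x ≤ f y) {G : M → ℝ≥0∞} :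
    IsWeakSubslope ℓ m f G ↔ AEMeasurable G m ∧ ∀ π : Measure (LCC ℓ), IsTestPlan m π →
      ∀ᵐ γ ∂π, LCC.increment f γ 0 1 ≠ ⊤ → ∀ᵐ t : ℝ, t ∈ Icc (0 : ℝ) 1 →
        G (γ.extend t) * causalSpeed γ t ≤ lowerDensity (LCC.increment f γ) t := by
  constructor
  · intro hG
    refine ⟨hG.1, fun π hπ => ?_⟩
    have hcell : ∀ᵐ γ ∂π, ∀ (n : ℕ) (k : ℤ),
        ∫⁻ t in Icc (projIcc 0 1 zero_le_one ((k : ℝ) / ((n : ℝ) + 1)) : ℝ)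
            (projIcc 0 1 zero_le_one (((k : ℝ) + 1) / ((n : ℝ) + 1))),
          G (γ.extend t) * causalSpeed γ t ≤
        LCC.increment f γ ((k : ℝ) / ((n : ℝ) + 1)) (((k : ℝ) + 1) / ((n : ℝ) + 1)) :=
      ae_all_iff.2 fun n => ae_all_iff.2 fun k =>
        hG.ae_setLIntegral_le hℓ hfin husc hπ (monotone_projIcc _ (by gcongr; linarith))
    filter_upwards [hcell, hG.ae_setLIntegral_le hℓ hfin husc hπ (zero_le_one' unitInterval),
      hπ.ae_ae_extend hG.1.ae_eq_mk] with γ h1 h2 h3 htop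
    let h : ℝ → ℝ≥0∞ := (Icc (0 : ℝ) 1).indicator fun t => G (γ.extend t) * causalSpeed γ t
    have hmeas : AEMeasurable h := by
      refine AEMeasurable.indicator ?_ measurableSet_Icc
      refine AEMeasurable.mul ⟨fun t => hG.1.mk G (γ.extend t), ?_, h3⟩
        (Measure.measurable_rnDeriv _ _).aemeasurable
      exact hG.1.measurable_mk.comp (LCC.measurable_extend.comp measurable_prodMk_left)
    have hae : ∀ᵐ t, h t ≤ lowerDensity (LCC.increment f γ) t := by
      refine ae_le_lowerDensity hmeas ?_ fun n k => ?_
      · rw [lintegral_indicator measurableSet_Icc]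
        refine ne_top_of_le_ne_top htop ?_
        rw [LCC.increment_zero_one]
        exact h2
      · rw [setLIntegral_indicator measurableSet_Icc]
        refine (lintegral_mono_set ?_).trans (h1 n k)
        rintro t ⟨ht, ht1, ht2⟩
        have e : ((projIcc 0 1 zero_le_one t : unitInterval) : ℝ) = t := by
          rw [projIcc_of_mem zero_le_one ht]
        rw [← e]
        exact ⟨monotone_projIcc (zero_le_one' ℝ) ht1.le, monotone_projIcc (zero_le_one' ℝ) ht2.le⟩
    filter_upwards [hae] with t ht hmem
    simpa only [h, indicator_of_mem hmem] using ht
  · rintro ⟨hG, h⟩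
    refine ⟨hG, fun π hπ => lintegral_mono_ae ?_⟩
    filter_upwards [h π hπ] with γ hγ
    rw [lintegral_unitInterval_mul_causalSpeed, ← LCC.increment_zero_one]
    by_cases htop : LCC.increment f γ 0 1 = ⊤
    · rw [htop]; exact le_top
    calc ∫⁻ t in Icc (0 : ℝ) 1, G (γ.extend t) * causalSpeed γ t
        ≤ ∫⁻ t in Icc (0 : ℝ) 1, lowerDensity (LCC.increment f γ) t :=
          setLIntegral_mono_ae' measurableSet_Icc (hγ htop)
      _ = ∫⁻ t in Ioo (0 : ℝ) 1, lowerDensity (LCC.increment f γ) t :=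
          (setLIntegral_congr Ioo_ae_eq_Icc).symm
      _ ≤ LCC.increment f γ 0 1 :=
          setLIntegral_lowerDensity_le (intervalSuperadditive_increment hf γ) 0 1

theorem isWeakSubslope_iSup (hℓ : IsRoughSpacetime ℓ) (hfin : ∀ x y, max (ℓ x y) 0 < ⊤)
    (husc : UpperSemicontinuous fun p : M × M => max (ℓ p.1 p.2) 0) {f : M → EReal}
    (hf : ∀ x y, 0 ≤ ℓ x y → f x ≤ f y) {G : ℕ → M → ℝ≥0∞}
    (hG : ∀ n, IsWeakSubslope ℓ m f (G n)) : IsWeakSubslope ℓ m f (fun x => ⨆ n, G n x) := by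
  rw [isWeakSubslope_iff_ae hℓ hfin husc hf]
  refine ⟨AEMeasurable.iSup fun n => (hG n).1, fun π hπ => ?_⟩
  filter_upwards [ae_all_iff.2 fun n =>
    ((isWeakSubslope_iff_ae hℓ hfin husc hf).1 (hG n)).2 π hπ] with γ hγ htop
  filter_upwards [ae_all_iff.2 fun n => hγ n htop] with t ht hmem
  rw [ENNReal.iSup_mul]
  exact iSup_le fun n => ht n hmem

end Subslope

/-- A nonempty family of measurable functions that is closed under countable suprema has an
almost everywhere largest element: one that maximizes the integral of a bounded strictly increasing
function of it, for an equivalent finite measure. -/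
theorem exists_ae_greatest_of_iSup_mem {α : Type*} [MeasurableSpace α] (μ : Measure α) [SFinite μ]
    {S : Set (α → ℝ≥0∞)} (hne : S.Nonempty) (hmeas : ∀ G ∈ S, AEMeasurable G μ)
    (hsup : ∀ G : ℕ → α → ℝ≥0∞, (∀ n, G n ∈ S) → (fun x => ⨆ n, G n x) ∈ S) :
    ∃ G ∈ S, ∀ G' ∈ S, G' ≤ᵐ[μ] G := by
  let φ : ℝ≥0∞ → ℝ≥0∞ := fun x => (x⁻¹ + 1)⁻¹
  have hφ : StrictMono φ := fun x y hxy => by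
    refine ENNReal.inv_lt_inv.2 (ENNReal.add_lt_add_right ENNReal.one_ne_top ?_)
    exact ENNReal.inv_lt_inv.2 hxy
  have hφ1 : ∀ x, φ x ≤ 1 := fun x => ENNReal.inv_le_one.2 le_add_self
  have hφm : Measurable φ := hφ.monotone.measurable
  let J : (α → ℝ≥0∞) → ℝ≥0∞ := fun G => ∫⁻ x, φ (G x) ∂μ.toFinite
  have hJ : ∀ G, J G ≠ ⊤ := fun G => by
    refine ne_top_of_le_ne_top (measure_ne_top μ.toFinite univ) ?_
    exact (lintegral_mono fun x => hφ1 (G x)).trans (by simp)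
  obtain ⟨u, -, hu, huS⟩ := exists_seq_tendsto_sSup (hne.image J) (OrderTop.bddAbove _)
  choose G hGS hGJ using huS
  refine ⟨_, hsup G hGS, fun G' hG' => ?_⟩
  set H : α → ℝ≥0∞ := fun x => ⨆ n, G n x with hH
  have hsupJ : sSup (J '' S) ≤ J H := le_of_tendsto' hu fun n => by
    rw [← hGJ n]
    exact lintegral_mono fun x => hφ.monotone (le_iSup (fun n => G n x) n)
  let K : α → ℝ≥0∞ := fun x => ⨆ n : ℕ, (if n = 0 then H else G') x
  have hKS : K ∈ S := hsup _ fun n => by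
    split_ifs
    · exact hsup G hGS
    · exact hG'
  have hHK : ∀ x, H x ≤ K x := fun x =>
    (le_iSup (fun n : ℕ => (if n = 0 then H else G') x) 0).trans_eq' (by simp)
  have hGK : ∀ x, G' x ≤ K x := fun x =>
    (le_iSup (fun n : ℕ => (if n = 0 then H else G') x) 1).trans_eq' (by simp)
  have hae : (fun x => φ (H x)) =ᵐ[μ.toFinite] fun x => φ (K x) :=
    ae_eq_of_ae_le_of_lintegral_le (Eventually.of_forall fun x => hφ.monotone (hHK x)) (hJ H)
      (hφm.comp_aemeasurable ((hmeas K hKS).mono_ac (toFinite_absolutelyContinuous μ)))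
      ((le_sSup (mem_image_of_mem J hKS)).trans hsupJ)
  filter_upwards [absolutelyContinuous_toFinite μ hae] with x hx
  exact (hGK x).trans (hφ.injective hx).ge

section MaxWeakSubslope

variable {M : Type*} [TopologicalSpace M] [MeasurableSpace M] {ℓ : M → M → EReal} {m : Measure M}

/-- Causal functions have a maximal weak subslope. -/
theorem exists_isMaximalWeakSubslope [BorelSpace M] [PolishSpace M] [SFinite m]
    (hℓ : IsRoughSpacetime ℓ) (hfin : ∀ x y, max (ℓ x y) 0 < ⊤)
    (husc : UpperSemicontinuous fun p : M × M => max (ℓ p.1 p.2) 0) {f : M → EReal}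
    (hf : ∀ x y, 0 ≤ ℓ x y → f x ≤ f y) : ∃ G, IsMaximalWeakSubslope ℓ m f G :=
  exists_ae_greatest_of_iSup_mem m (S := {G | IsWeakSubslope ℓ m f G})
    ⟨0, aemeasurable_const, fun _ _ => by simp⟩ (fun _ hG => hG.1)
    fun _ hG => isWeakSubslope_iSup hℓ hfin husc hf hG

theorem isMaximalWeakSubslope_maxWeakSubslope {f : M → EReal}
    (h : ∃ G, IsMaximalWeakSubslope ℓ m f G) :
    IsMaximalWeakSubslope ℓ m f (maxWeakSubslope ℓ m f) := by
  rw [maxWeakSubslope, dif_pos h]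
  exact h.choose_spec

theorem IsMaximalWeakSubslope.ae_eq_maxWeakSubslope {f : M → EReal} {G : M → ℝ≥0∞}
    (hG : IsMaximalWeakSubslope ℓ m f G) : G =ᵐ[m] maxWeakSubslope ℓ m f :=
  have h := isMaximalWeakSubslope_maxWeakSubslope ⟨G, hG⟩
  (h.2 G hG.1).antisymm (hG.2 _ h.1)

end MaxWeakSubslope

/-! ### Transport of causal paths -/

theorem IsForwardMetricSpacetime.tendsto_nhdsLT_of_seq {M : Type*} [TopologicalSpace M]
    {ℓ : M → M → EReal} (hℓ : IsForwardMetricSpacetime ℓ) {c : unitInterval → M}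
    (hc : ∀ s t, s ≤ t → 0 ≤ ℓ (c s) (c t)) {t : unitInterval} {s : ℕ → unitInterval}
    (hs : ∀ n, s n < t) (hlim : Tendsto (fun n => c (s n)) atTop (𝓝 (c t))) :
    Tendsto c (𝓝[<] t) (𝓝 (c t)) := by
  refine hℓ.tendsto_nhds_iff.2 ⟨fun p hp => ?_, fun q hq => ?_⟩
  · obtain ⟨n, hn⟩ := ((hℓ.tendsto_nhds_iff.1 hlim).1 p hp).exists
    filter_upwards [Ioo_mem_nhdsLT (hs n)] with r hr
    exact hn.trans_le (hℓ.le_of_causal_right p (hc _ _ hr.1.le))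
  · filter_upwards [self_mem_nhdsWithin] with r hr
    exact hq.trans_le (hℓ.le_of_causal_left q (hc _ _ (le_of_lt hr)))

/-- Surjective order embeddings between closed sets of forward metric spacetimes preserve the
left-continuity of causal paths. Forward completeness gives a left limit `T x` of the image path,
and the order forces `x` to be the left limit of the original path. -/
theorem tendsto_comp_of_orderEmbedding {M₁ M₂ : Type*} [TopologicalSpace M₁] [TopologicalSpace M₂]
    {ℓ₁ : M₁ → M₁ → EReal} {ℓ₂ : M₂ → M₂ → EReal} (hℓ₁ : IsForwardMetricSpacetime ℓ₁)
    (hℓ₂ : IsForwardMetricSpacetime ℓ₂) {A₁ : Set M₁} {A₂ : Set M₂} (hA₂ : IsClosed A₂)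
    {T : A₁ → A₂} (hT : Function.Surjective T)
    (hord : ∀ x y : A₁, 0 ≤ ℓ₁ x y ↔ 0 ≤ ℓ₂ (T x) (T y)) (γ : LCC ℓ₁) (hγ : ∀ t, γ t ∈ A₁)
    {t : unitInterval} (ht : 0 < t) :
    Tendsto (fun s => (T ⟨γ s, hγ s⟩ : M₂)) (𝓝[<] t) (𝓝 (T ⟨γ t, hγ t⟩)) := by
  have := hℓ₂.polish
  have hc : ∀ s t, s ≤ t → 0 ≤ ℓ₂ (T ⟨γ s, hγ s⟩) (T ⟨γ t, hγ t⟩) := fun s t hst =>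
    (hord _ _).1 (γ.causal' s t hst)
  obtain ⟨s, hs, hst, hlim⟩ := exists_seq_strictMono_tendsto' ht
  obtain ⟨w, hw⟩ := hℓ₂.forward_complete (fun i => T ⟨γ (s i.toNat), hγ _⟩) (T ⟨γ 0, hγ 0⟩)
    (T ⟨γ 1, hγ 1⟩) (fun i => hc _ _ unitInterval.nonneg')
    (fun i => hc _ _ (hs.monotone (Int.toNat_le_toNat (by omega))))
    (fun i => hc _ _ unitInterval.le_one')
  have hw' : Tendsto (fun n : ℕ => (T ⟨γ (s n), hγ _⟩ : M₂)) atTop (𝓝 w) := by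
    simpa [Function.comp_def] using hw.comp tendsto_natCast_atTop_atTop
  have hwA : w ∈ A₂ := hA₂.mem_of_tendsto hw' (Eventually.of_forall fun n => (T _).2)
  obtain ⟨x, hx⟩ := hT ⟨w, hwA⟩
  have hxw : (T x : M₂) = w := by rw [hx]
  have h1 : ∀ n, 0 ≤ ℓ₁ (γ (s n)) x := fun n => by
    refine (hord ⟨_, hγ _⟩ x).2 ?_
    rw [hxw]
    refine hℓ₂.causal_of_tendsto tendsto_const_nhds hw' ?_
    filter_upwards [eventually_ge_atTop n] with k hk
    exact hc _ _ (hs.monotone hk)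
  have h2 : 0 ≤ ℓ₁ x (γ t) := by
    refine (hord x ⟨_, hγ _⟩).2 ?_
    rw [hxw]
    exact hℓ₂.causal_of_tendsto hw' tendsto_const_nhds
      (Eventually.of_forall fun n => hc _ _ (hst n).2.le)
  have hγlim : Tendsto (fun n => γ (s n)) atTop (𝓝 (γ t)) :=
    (γ.left_continuous' t ht).comp (tendsto_nhdsWithin_iff.2
      ⟨hlim, Eventually.of_forall fun n => (hst n).2⟩)
  have h3 : 0 ≤ ℓ₁ (γ t) x :=
    hℓ₁.causal_of_tendsto hγlim tendsto_const_nhds (Eventually.of_forall h1)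
  have hxt : x = ⟨γ t, hγ t⟩ := Subtype.ext (hℓ₁.causal_antisymm h2 h3)
  rw [← hxw, hxt] at hw'
  exact hℓ₂.tendsto_nhdsLT_of_seq hc (fun n => (hst n).2) hw'

theorem bijective_of_causal_iff {M₁ M₂ : Type*} [TopologicalSpace M₁]
    {ℓ₁ : M₁ → M₁ → EReal} {ℓ₂ : M₂ → M₂ → EReal} {A₁ : Set M₁} {A₂ : Set M₂}
    (hℓ₁ : IsForwardMetricSpacetime ℓ₁) (hℓ₂ : IsRoughSpacetime ℓ₂)
    {T : A₁ → A₂} (hT : Function.Surjective T)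
    (hord : ∀ x y : A₁, 0 ≤ ℓ₁ x y ↔ 0 ≤ ℓ₂ (T x) (T y)) : Function.Bijective T := by
  refine ⟨fun x y hxy => Subtype.ext (hℓ₁.causal_antisymm ?_ ?_), hT⟩
  · rw [hord, hxy]; exact hℓ₂.diag_nonneg _
  · rw [hord, hxy]; exact hℓ₂.diag_nonneg _

namespace LCC

variable {M₁ M₂ : Type*} [TopologicalSpace M₁] [TopologicalSpace M₂] {ℓ₁ : M₁ → M₁ → EReal}
  {ℓ₂ : M₂ → M₂ → EReal}

/-- Constant paths. -/
def const (hℓ₂ : IsRoughSpacetime ℓ₂) (y : M₂) : LCC ℓ₂ where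
  toFun _ := y
  causal' _ _ _ := hℓ₂.diag_nonneg y
  left_continuous' _ _ := tendsto_const_nhds

open Classical in
/-- The map on paths that is induced by a surjective order embedding `T` between closed sets. Paths
that leave the domain of `T` are sent to a constant path. -/
noncomputable def map (hℓ₁ : IsForwardMetricSpacetime ℓ₁) (hℓ₂ : IsForwardMetricSpacetime ℓ₂)
    {A₁ : Set M₁} {A₂ : Set M₂} (hA₂ : IsClosed A₂) {T : A₁ → A₂} (hT : Function.Surjective T)
    (hord : ∀ x y : A₁, 0 ≤ ℓ₁ x y ↔ 0 ≤ ℓ₂ (T x) (T y)) (y₀ : M₂) (γ : LCC ℓ₁) : LCC ℓ₂ :=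
  if hγ : ∀ t, γ t ∈ A₁ then
    { toFun := fun t => T ⟨γ t, hγ t⟩
      causal' := fun s t hst => (hord _ _).1 (γ.causal' s t hst)
      left_continuous' := fun _ ht =>
        tendsto_comp_of_orderEmbedding hℓ₁ hℓ₂ hA₂ hT hord γ hγ ht }
  else const hℓ₂.toIsRoughSpacetime y₀

theorem map_apply (hℓ₁ : IsForwardMetricSpacetime ℓ₁) (hℓ₂ : IsForwardMetricSpacetime ℓ₂)
    {A₁ : Set M₁} {A₂ : Set M₂} (hA₂ : IsClosed A₂) {T : A₁ → A₂} (hT : Function.Surjective T)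
    (hord : ∀ x y : A₁, 0 ≤ ℓ₁ x y ↔ 0 ≤ ℓ₂ (T x) (T y)) (y₀ : M₂) (γ : LCC ℓ₁)
    (hγ : ∀ t, γ t ∈ A₁) (t : unitInterval) :
    map hℓ₁ hℓ₂ hA₂ hT hord y₀ γ t = T ⟨γ t, hγ t⟩ := by
  rw [map, dif_pos hγ]

theorem measurable_map [MeasurableSpace M₁] [BorelSpace M₁] [MeasurableSpace M₂]
    (hℓ₁ : IsForwardMetricSpacetime ℓ₁)
    (hℓ₂ : IsForwardMetricSpacetime ℓ₂) {A₁ : Set M₁} {A₂ : Set M₂} (hA₁ : IsClosed A₁)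
    (hA₂ : IsClosed A₂) {T : A₁ → A₂} (hT : Function.Surjective T)
    (hord : ∀ x y : A₁, 0 ≤ ℓ₁ x y ↔ 0 ≤ ℓ₂ (T x) (T y)) (y₀ : M₂) (hTm : Measurable T) :
    Measurable (map hℓ₁ hℓ₂ hA₂ hT hord y₀) := by
  classical
  refine measurable_of_eval fun t => ?_
  have h : (fun γ : LCC ℓ₁ => map hℓ₁ hℓ₂ hA₂ hT hord y₀ γ t) = fun γ : LCC ℓ₁ =>
      if hγ : γ ∈ {γ : LCC ℓ₁ | ∀ t, γ t ∈ A₁} then (T ⟨γ t, hγ t⟩ : M₂) else y₀ := by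
    ext γ
    by_cases hγ : ∀ t, γ t ∈ A₁
    · rw [map_apply _ _ _ _ _ _ _ hγ, dif_pos (by exact hγ)]
    · rw [map, dif_neg hγ, dif_neg (by exact hγ)]
      rfl
  rw [h]
  refine Measurable.dite (s := {γ : LCC ℓ₁ | ∀ t, γ t ∈ A₁})
    (f := fun γ => (T ⟨γ.1 t, γ.2 t⟩ : M₂)) (g := fun _ => y₀) ?_ measurable_const
    (measurableSet_forall_mem hA₁)
  exact measurable_subtype_coe.comp (hTm.comp
    (((measurable_eval t).comp measurable_subtype_coe).subtype_mk))

theorem causalSpeed_eq_of_separation_eq {γ₁ : LCC ℓ₁} {γ₂ : LCC ℓ₂}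
    (h : γ₁.separation = γ₂.separation) : causalSpeed γ₁ = causalSpeed γ₂ := by
  ext t
  rw [causalSpeed, causalSpeed, causalSpeedMeasure_eq, causalSpeedMeasure_eq, h]

end LCC

/-! ### Measures and their support -/

section Support

variable {M : Type*} [TopologicalSpace M] [MeasurableSpace M] {m : Measure M}

theorem extendSupport_apply (g : m.support → EReal) (x : m.support) : extendSupport g x = g x :=
  Subtype.val_injective.extend_apply g _ x

variable [BorelSpace M]

theorem measurableEmbedding_val_support : MeasurableEmbedding (Subtype.val : m.support → M) :=
  MeasurableEmbedding.subtype_coe Measure.isClosed_support.measurableSet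

theorem map_val_comap_support [PolishSpace M] : (m.comap (Subtype.val : m.support → M)).map
    Subtype.val = m := by
  rw [map_comap_subtype_coe Measure.isClosed_support.measurableSet]
  exact Measure.restrict_eq_self_of_ae_mem Measure.support_mem_ae

theorem ae_comap_support_iff [PolishSpace M] {P : M → Prop} :
    (∀ᵐ x : m.support ∂(m.comap Subtype.val), P x) ↔ ∀ᵐ x ∂m, P x := by
  conv_rhs => rw [← map_val_comap_support (m := m)]
  exact measurableEmbedding_val_support.ae_map_iff.symm

theorem aemeasurable_comap_support_iff [PolishSpace M] {β : Type*} [MeasurableSpace β]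
    {g : M → β} : AEMeasurable (fun x : m.support => g x) (m.comap Subtype.val) ↔
      AEMeasurable g m := by
  conv_rhs => rw [← map_val_comap_support (m := m)]
  exact measurableEmbedding_val_support.aemeasurable_map_iff.symm

end Support

/-! ### Transport of weak subslopes -/

section Transport

variable {M₁ M₂ : Type*} [TopologicalSpace M₁] [MeasurableSpace M₁] [BorelSpace M₁]
  [PolishSpace M₁] [TopologicalSpace M₂] [MeasurableSpace M₂] [BorelSpace M₂] [PolishSpace M₂]
  {ℓ₁ : M₁ → M₁ → EReal} {ℓ₂ : M₂ → M₂ → EReal} {m₁ : Measure M₁} {m₂ : Measure M₂}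

/-- Weak subslopes pull back along measure-preserving maps between the supports that preserve the
time separation, because such maps push test plans to test plans. -/
theorem IsWeakSubslope.of_comp (hℓ₁ : IsForwardMetricSpacetime ℓ₁)
    (hℓ₂ : IsForwardMetricSpacetime ℓ₂) (hfin₂ : ∀ x y, max (ℓ₂ x y) 0 < ⊤)
    (husc₂ : UpperSemicontinuous fun p : M₂ × M₂ => max (ℓ₂ p.1 p.2) 0)
    {T : m₁.support → m₂.support} (hTm : Measurable T) (hT : Function.Surjective T)
    (hpush : (m₁.comap Subtype.val).map (fun x => (T x : M₂)) = m₂)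
    (hiso : ∀ x y : m₁.support, ℓ₂ (T x) (T y) = ℓ₁ x y) {f₁ : M₁ → EReal} {f₂ : M₂ → EReal}
    {G₁ : M₁ → ℝ≥0∞} {G₂ : M₂ → ℝ≥0∞} (hf : ∀ x : m₁.support, f₁ x = f₂ (T x))
    (hG : ∀ x : m₁.support, G₁ x = G₂ (T x)) (h : IsWeakSubslope ℓ₂ m₂ f₂ G₂) :
    IsWeakSubslope ℓ₁ m₁ f₁ G₁ := by
  have hTv : Measurable fun x : m₁.support => (T x : M₂) := measurable_subtype_coe.comp hTm
  constructor
  · rw [← aemeasurable_comap_support_iff]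
    simp only [hG]
    have hG₂ := h.1
    rw [← hpush] at hG₂
    exact hG₂.comp_measurable hTv
  intro π hπ
  have := hπ.isProbabilityMeasure
  have hmem : ∀ᵐ γ ∂π, ∀ t, γ t ∈ m₁.support :=
    hπ.ae_forall_mem Measure.isClosed_support Measure.support_mem_ae
  obtain ⟨γ₀, hγ₀⟩ := hmem.exists
  let y₀ : M₂ := T ⟨γ₀ 0, hγ₀ 0⟩
  let Φ : LCC ℓ₁ → LCC ℓ₂ := LCC.map hℓ₁ hℓ₂ Measure.isClosed_support hT
    (fun x y => by rw [hiso]) y₀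
  have hΦm : Measurable Φ := LCC.measurable_map hℓ₁ hℓ₂ Measure.isClosed_support
    Measure.isClosed_support hT _ y₀ hTm
  have hΦ : ∀ (γ : LCC ℓ₁) (hγ : ∀ t, γ t ∈ m₁.support) (t : unitInterval),
      Φ γ t = T ⟨γ t, hγ t⟩ := LCC.map_apply hℓ₁ hℓ₂ _ hT _ y₀
  have hspeed : ∀ γ : LCC ℓ₁, (∀ t, γ t ∈ m₁.support) → causalSpeed (Φ γ) = causalSpeed γ := by
    intro γ hγ
    refine LCC.causalSpeed_eq_of_separation_eq ?_
    ext a b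
    rw [LCC.separation, LCC.separation, LCC.extend, LCC.extend, hΦ γ hγ, hΦ γ hγ, hiso]
    rfl
  have hplan : IsTestPlan m₂ (π.map Φ) := by
    refine ⟨Measure.isProbabilityMeasure_map hΦm.aemeasurable, ?_⟩
    obtain ⟨C, hC0, hC⟩ := hπ.bounded_compression
    refine ⟨C, hC0, fun t => Measure.le_iff.2 fun B hB => ?_⟩
    have hBm : MeasurableSet (Subtype.val '' {x : m₁.support | (T x : M₂) ∈ B}) :=
      measurableEmbedding_val_support.measurableSet_image.2 (hTv hB)
    calc (π.map Φ).map (fun γ : LCC ℓ₂ => γ t) B = π {γ | Φ γ t ∈ B} := by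
          rw [Measure.map_map (LCC.measurable_eval t) hΦm,
            Measure.map_apply ((LCC.measurable_eval t).comp hΦm) hB]
          rfl
      _ ≤ π {γ | γ t ∈ Subtype.val '' {x : m₁.support | (T x : M₂) ∈ B}} := by
          refine measure_mono_ae ?_
          filter_upwards [hmem] with γ hγ hB'
          have hB' : Φ γ t ∈ B := hB'
          rw [hΦ γ hγ] at hB'
          exact ⟨⟨γ t, hγ t⟩, hB', rfl⟩
      _ = π.map (fun γ : LCC ℓ₁ => γ t) (Subtype.val '' {x : m₁.support | (T x : M₂) ∈ B}) :=
          (Measure.map_apply (LCC.measurable_eval t) hBm).symm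
      _ ≤ (C : ℝ≥0∞) * m₁ (Subtype.val '' {x : m₁.support | (T x : M₂) ∈ B}) := hC t _
      _ = (C : ℝ≥0∞) * m₂ B := by
          conv_rhs => rw [← hpush]
          rw [Measure.map_apply hTv hB, measurableEmbedding_val_support.comap_apply]
          rfl
  have hineq := h.lintegral_le hplan
  rw [lintegral_map' (hplan.aemeasurable_lintegral hℓ₂.toIsRoughSpacetime hfin₂ husc₂ h.1 _)
    hΦm.aemeasurable] at hineq
  have hineq := hineq.trans (lintegral_map_le _ _)
  simp only [lintegral_unitInterval_mul_causalSpeed]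
  refine le_of_eq_of_le (lintegral_congr_ae ?_) (hineq.trans_eq (lintegral_congr_ae ?_))
  · filter_upwards [hmem] with γ hγ
    rw [hspeed γ hγ]
    refine lintegral_congr fun t => ?_
    rw [LCC.extend, LCC.extend, hΦ γ hγ]
    exact congrArg (· * _) (hG ⟨_, hγ _⟩)
  · filter_upwards [hmem] with γ hγ
    rw [hΦ γ hγ, hΦ γ hγ, ← hf, ← hf]

theorem ae_iff_ae_comp {T : m₁.support → m₂.support} (hTm : Measurable T)
    (hT : Function.Injective T) (hpush : (m₁.comap Subtype.val).map (fun x => (T x : M₂)) = m₂)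
    {P : M₂ → Prop} :
    (∀ᵐ y ∂m₂, P y) ↔ ∀ᵐ x : m₁.support ∂(m₁.comap Subtype.val), P (T x) := by
  have : PolishSpace m₁.support := Measure.isClosed_support.polishSpace
  have hTe : MeasurableEmbedding fun x : m₁.support => (T x : M₂) :=
    (measurable_subtype_coe.comp hTm).measurableEmbedding (Subtype.val_injective.comp hT)
  conv_lhs => rw [← hpush]
  exact hTe.ae_map_iff

/-- The inverse of a measure-preserving Borel bijection between supports is measurable, by the
Lusin–Souslin theorem, and measure-preserving. -/
theorem exists_measurable_inverse {T : m₁.support → m₂.support} (hTm : Measurable T)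
    (hT : Function.Bijective T)
    (hpush : (m₁.comap Subtype.val).map (fun x => (T x : M₂)) = m₂) :
    ∃ S : m₂.support → m₁.support, Measurable S ∧ Function.LeftInverse S T ∧
      Function.RightInverse S T ∧ (m₂.comap Subtype.val).map (fun y => (S y : M₁)) = m₁ := by
  have : PolishSpace m₁.support := Measure.isClosed_support.polishSpace
  have hTe : MeasurableEmbedding T := hTm.measurableEmbedding hT.1
  let e := Equiv.ofBijective T hT
  have hSm : Measurable e.symm := fun A hA => by
    rw [← e.image_eq_preimage_symm]
    exact hTe.measurableSet_image.2 hA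
  refine ⟨e.symm, hSm, e.symm_apply_apply, e.apply_symm_apply, ?_⟩
  have h : m₂.comap (Subtype.val : m₂.support → M₂) = (m₁.comap Subtype.val).map T := by
    rw [← measurableEmbedding_val_support.comap_map ((m₁.comap Subtype.val).map T),
      Measure.map_map measurable_subtype_coe hTm]
    congr 1
    exact hpush.symm
  have hSv : Measurable fun y => (e.symm y : M₁) := measurable_subtype_coe.comp hSm
  rw [h, Measure.map_map hSv hTm]
  have h' : (fun y => (e.symm y : M₁)) ∘ T = Subtype.val := by
    ext x
    exact congrArg Subtype.val (e.symm_apply_apply x)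
  rw [h', map_val_comap_support]

/-- Maximal weak subslopes are transported by measure-preserving surjections between the supports
that preserve the time separation. -/
theorem maxWeakSubslope_comp [SFinite m₂] (hℓ₁ : IsForwardMetricSpacetime ℓ₁)
    (hℓ₂ : IsForwardMetricSpacetime ℓ₂) (hfin₁ : ∀ x y, max (ℓ₁ x y) 0 < ⊤)
    (hfin₂ : ∀ x y, max (ℓ₂ x y) 0 < ⊤)
    (husc₁ : UpperSemicontinuous fun p : M₁ × M₁ => max (ℓ₁ p.1 p.2) 0)
    (husc₂ : UpperSemicontinuous fun p : M₂ × M₂ => max (ℓ₂ p.1 p.2) 0)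
    {T : m₁.support → m₂.support} (hTm : Measurable T) (hT : Function.Surjective T)
    (hpush : (m₁.comap Subtype.val).map (fun x => (T x : M₂)) = m₂)
    (hiso : ∀ x y : m₁.support, ℓ₂ (T x) (T y) = ℓ₁ x y) {f : M₂ → EReal}
    (hf : ∀ x y, 0 ≤ ℓ₂ x y → f x ≤ f y) :
    ∀ᵐ x : m₁.support ∂(m₁.comap Subtype.val),
      maxWeakSubslope ℓ₁ m₁ (extendSupport fun z => f (T z)) (x : M₁) =
        maxWeakSubslope ℓ₂ m₂ f (T x : M₂) := by
  have hbij := bijective_of_causal_iff hℓ₁ hℓ₂.toIsRoughSpacetime hT fun x y => by rw [hiso]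
  obtain ⟨S, hSm, hST, hTS, hSpush⟩ := exists_measurable_inverse hTm hbij hpush
  have hSiso : ∀ x y : m₂.support, ℓ₁ (S x) (S y) = ℓ₂ x y := fun x y => by
    rw [← hiso, hTS, hTS]
  have hmax := isMaximalWeakSubslope_maxWeakSubslope
    (exists_isMaximalWeakSubslope (m := m₂) hℓ₂.toIsRoughSpacetime hfin₂ husc₂ hf)
  set G₂ := maxWeakSubslope ℓ₂ m₂ f
  let G₁ : M₁ → ℝ≥0∞ := Function.extend Subtype.val (fun x : m₁.support => G₂ (T x)) 0
  have hG₁ : ∀ x : m₁.support, G₁ x = G₂ (T x) := Subtype.val_injective.extend_apply _ _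
  have hmax₁ : IsMaximalWeakSubslope ℓ₁ m₁ (extendSupport fun z => f (T z)) G₁ := by
    refine ⟨hmax.1.of_comp hℓ₁ hℓ₂ hfin₂ husc₂ hTm hT hpush hiso
      (fun x => extendSupport_apply _ x) hG₁, fun G' hG' => ?_⟩
    let G'' : M₂ → ℝ≥0∞ := Function.extend Subtype.val (fun y : m₂.support => G' (S y)) 0
    have hG'' : ∀ y : m₂.support, G'' y = G' (S y) := Subtype.val_injective.extend_apply _ _
    have hle := hmax.2 G'' (hG'.of_comp hℓ₂ hℓ₁ hfin₁ husc₁ hSm hST.surjective hSpush hSiso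
      (fun y => by rw [extendSupport_apply, hTS]) hG'')
    refine ae_comap_support_iff.1 ?_
    filter_upwards [(ae_iff_ae_comp hTm hbij.1 hpush).1 hle] with x hx
    rwa [hG'', hST, ← hG₁] at hx
  filter_upwards [ae_comap_support_iff.2 hmax₁.ae_eq_maxWeakSubslope] with x hx
  rw [← hx, hG₁]

end Transport

/-! ### Steep functions -/

section Steep

variable {M : Type*} [TopologicalSpace M] [MeasurableSpace M] {ℓ : M → M → EReal} {m : Measure M}

theorem isWeakSubslope_one (hℓ : IsRoughSpacetime ℓ) (hfin : ∀ x y, max (ℓ x y) 0 < ⊤)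
    {f : M → EReal} (hf : ∀ x y, ℓ x y ≤ extDiff (f y) (f x)) : IsWeakSubslope ℓ m f 1 := by
  refine ⟨aemeasurable_const, fun π _ => lintegral_mono fun γ => ?_⟩
  rw [lintegral_unitInterval_mul_causalSpeed]
  simp only [Pi.one_apply, one_mul]
  exact (γ.lintegral_causalSpeed_le hℓ hfin).trans (EReal.toENNReal_le_toENNReal (hf _ _))

/-- Weak subslopes do not depend on the values of the function outside of the support. -/
theorem IsWeakSubslope.congr_support [BorelSpace M] [PolishSpace M] {f f' : M → EReal}
    {G : M → ℝ≥0∞} (hG : IsWeakSubslope ℓ m f G) (hff' : ∀ x ∈ m.support, f x = f' x) :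
    IsWeakSubslope ℓ m f' G := by
  refine ⟨hG.1, fun π hπ => (hG.2 π hπ).trans_eq (lintegral_congr_ae ?_)⟩
  filter_upwards [hπ.ae_forall_mem Measure.isClosed_support Measure.support_mem_ae] with γ hγ
  rw [hff' _ (hγ 0), hff' _ (hγ 1)]

theorem maxWeakSubslope_congr_support [BorelSpace M] [PolishSpace M] [SFinite m]
    (hℓ : IsRoughSpacetime ℓ) (hfin : ∀ x y, max (ℓ x y) 0 < ⊤)
    (husc : UpperSemicontinuous fun p : M × M => max (ℓ p.1 p.2) 0) {f f' : M → EReal}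
    (hf : ∀ x y, 0 ≤ ℓ x y → f x ≤ f y) (hff' : ∀ x ∈ m.support, f x = f' x) :
    maxWeakSubslope ℓ m f =ᵐ[m] maxWeakSubslope ℓ m f' := by
  have hmax := isMaximalWeakSubslope_maxWeakSubslope
    (exists_isMaximalWeakSubslope (m := m) hℓ hfin husc hf)
  exact IsMaximalWeakSubslope.ae_eq_maxWeakSubslope ⟨hmax.1.congr_support hff',
    fun G' hG' => hmax.2 G' (hG'.congr_support fun x hx => (hff' x hx).symm)⟩

theorem measurable_separationFrom [BorelSpace M] [PolishSpace M]
    (hℓ : IsForwardMetricSpacetime ℓ)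
    (husc : UpperSemicontinuous fun p : M × M => max (ℓ p.1 p.2) 0) (p : M) :
    Measurable fun y => ℓ p y := by
  classical
  have h : (fun y => ℓ p y) = fun y => if 0 ≤ ℓ p y then max (ℓ p y) 0 else ⊥ := by
    ext y
    split_ifs with h
    · rw [max_eq_left h]
    · exact (hℓ.eq_bot_or_nonneg p y).resolve_right h
  rw [h]
  have hpair : Measurable fun y : M => (p, y) := measurable_prodMk_left
  exact Measurable.ite (hpair hℓ.isClosed_causal.measurableSet) (husc.measurable.comp hpair)
    measurable_const

/-- The time separation from a point is steep, hence its maximal weak subslope is at least `1`. -/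
theorem one_le_maxWeakSubslope_separationFrom [BorelSpace M] [PolishSpace M] [SFinite m]
    (hℓ : IsRoughSpacetime ℓ) (hfin : ∀ x y, max (ℓ x y) 0 < ⊤)
    (husc : UpperSemicontinuous fun p : M × M => max (ℓ p.1 p.2) 0) (p : M) :
    ∀ᵐ x ∂m, 1 ≤ maxWeakSubslope ℓ m (fun y => ℓ p y) x :=
  (isMaximalWeakSubslope_maxWeakSubslope (exists_isMaximalWeakSubslope hℓ hfin husc
    fun _ _ h => hℓ.le_of_causal_right p h)).2 1 (isWeakSubslope_one hℓ hfin fun x y =>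
      le_extDiff_iff.2 ((add_comm _ _).trans_le (hℓ.add_le p x y)))

/-- A measurable monotone function on the support extends to a causal function, by its supremum
over the part of the support in the past of a point. -/
theorem exists_isCausalFunction_extension [BorelSpace M] [PolishSpace M] (hℓ : IsRoughSpacetime ℓ)
    {h : m.support → EReal} (hm : Measurable h)
    (hmono : ∀ x y : m.support, 0 ≤ ℓ x y → h x ≤ h y) :
    ∃ g : M → EReal, IsCausalFunction ℓ m g ∧ ∀ x : m.support, g x = h x := by
  let g : M → EReal := fun z => ⨆ (w : m.support) (_ : 0 ≤ ℓ w z), h w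
  have hg : ∀ x : m.support, g x = h x := fun x => le_antisymm
    (iSup₂_le fun w hw => hmono w x hw) (le_iSup₂_of_le x (hℓ.diag_nonneg x) le_rfl)
  refine ⟨g, ⟨aemeasurable_comap_support_iff.1 ?_, fun x y hxy => iSup₂_le fun w hw => ?_⟩, hg⟩
  · simpa only [hg] using hm.aemeasurable
  · exact le_iSup₂_of_le w (hℓ.causal_trans hw hxy) le_rfl

end Steep

theorem theorem5p24
    {M₁ : Type*} [TopologicalSpace M₁] [MeasurableSpace M₁] [BorelSpace M₁]
    {M₂ : Type*} [TopologicalSpace M₂] [MeasurableSpace M₂] [BorelSpace M₂]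
    (ℓ₁ : M₁ → M₁ → EReal) (ℓ₂ : M₂ → M₂ → EReal)
    (hℓ₁ : IsForwardMetricSpacetime ℓ₁) (hℓ₂ : IsForwardMetricSpacetime ℓ₂)
    (m₁ : Measure M₁) [IsLocallyFiniteMeasure m₁]
    (m₂ : Measure M₂) [IsLocallyFiniteMeasure m₂]
    (hS₁ : SobolevToSteepness ℓ₁ m₁) (hS₂ : SobolevToSteepness ℓ₂ m₂)
    (husc₁ : UpperSemicontinuous fun p : M₁ × M₁ => max (ℓ₁ p.1 p.2) 0)
    (husc₂ : UpperSemicontinuous fun p : M₂ × M₂ => max (ℓ₂ p.1 p.2) 0)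
    (hfin₁ : ∀ x y, max (ℓ₁ x y) 0 < ⊤) (hfin₂ : ∀ x y, max (ℓ₂ x y) 0 < ⊤)
    (T : m₁.support → m₂.support) (hTmeas : Measurable T) (hTsurj : Function.Surjective T)
    (hTpush : (m₁.comap Subtype.val).map (fun x => (T x : M₂)) = m₂) :
    (∀ x y : m₁.support, ℓ₂ (T x) (T y) = ℓ₁ x y) ↔
      (∀ x y : m₁.support, 0 ≤ ℓ₁ x y ↔ 0 ≤ ℓ₂ (T x) (T y)) ∧
      ∀ f : M₂ → EReal, IsCausalFunction ℓ₂ m₂ f →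
        ∀ᵐ x : m₁.support ∂(m₁.comap Subtype.val),
          maxWeakSubslope ℓ₁ m₁ (extendSupport fun z => f (T z)) (x : M₁) =
            maxWeakSubslope ℓ₂ m₂ f (T x : M₂) := by
  have := hℓ₁.polish
  have := hℓ₂.polish
  have hr₁ := hℓ₁.toIsRoughSpacetime
  have hr₂ := hℓ₂.toIsRoughSpacetime
  have hTv : Measurable fun x : m₁.support => (T x : M₂) := measurable_subtype_coe.comp hTmeas
  constructor
  · intro hiso
    exact ⟨fun x y => by rw [hiso], fun f hf => maxWeakSubslope_comp hℓ₁ hℓ₂ hfin₁ hfin₂ husc₁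
      husc₂ hTmeas hTsurj hTpush hiso hf.monotone⟩
  rintro ⟨hord, hslope⟩ x y
  obtain ⟨S, hSm, hST, hTS, -⟩ := exists_measurable_inverse hTmeas
    (bijective_of_causal_iff hℓ₁ hr₂ hTsurj hord) hTpush
  refine le_antisymm ?_ ?_
  · -- Push the time separation from `x` forward to `M₂`.
    obtain ⟨g, hg, hgS⟩ := exists_isCausalFunction_extension (m := m₂) hr₂
      (h := fun w => ℓ₁ x (S w))
      ((measurable_separationFrom hℓ₁ husc₁ x).comp (measurable_subtype_coe.comp hSm))
      (fun u v huv => hr₁.le_of_causal_right x ((hord _ _).2 (by rwa [hTS, hTS])))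
    have hgT : ∀ z : m₁.support, g (T z) = ℓ₁ x z := fun z => by rw [hgS, hST]
    have hcongr := maxWeakSubslope_congr_support (m := m₁) hr₁ hfin₁ husc₁
      (f := fun z => ℓ₁ x z) (f' := extendSupport fun z => g (T z))
      (fun _ _ h => hr₁.le_of_causal_right x h)
      (fun z hz => by rw [extendSupport_apply _ ⟨z, hz⟩, hgT])
    have h1 : ∀ᵐ z ∂m₂, 1 ≤ maxWeakSubslope ℓ₂ m₂ g z := by
      rw [ae_iff_ae_comp hTmeas hST.injective hTpush]
      filter_upwards [hslope g hg, ae_comap_support_iff.2 hcongr, ae_comap_support_iff.2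
        (one_le_maxWeakSubslope_separationFrom (m := m₁) hr₁ hfin₁ husc₁ (x : M₁))]
        with z h1 h2 h3
      rwa [← h1, ← h2]
    have h2 := hS₂ g hg h1 (T x) (T x).2 (T y) (T y).2
    rw [hgT, hgT, le_extDiff_iff] at h2
    exact (le_add_of_nonneg_right (hr₁.diag_nonneg _)).trans h2
  · -- Pull the time separation from `T x` back to `M₁`.
    have hf : IsCausalFunction ℓ₂ m₂ fun z => ℓ₂ (T x) z :=
      ⟨(measurable_separationFrom hℓ₂ husc₂ _).aemeasurable,
        fun _ _ h => hr₂.le_of_causal_right _ h⟩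
    obtain ⟨g, hg, hgT⟩ := exists_isCausalFunction_extension (m := m₁) hr₁
      (h := fun w => ℓ₂ (T x) (T w)) ((measurable_separationFrom hℓ₂ husc₂ _).comp hTv)
      (fun u v huv => hr₂.le_of_causal_right _ ((hord _ _).1 huv))
    have hcongr := maxWeakSubslope_congr_support (m := m₁) hr₁ hfin₁ husc₁
      (f' := extendSupport fun z => ℓ₂ (T x) (T z)) hg.monotone
      (fun z hz => by rw [extendSupport_apply _ ⟨z, hz⟩, hgT ⟨z, hz⟩])
    have h1 : ∀ᵐ z ∂m₁, 1 ≤ maxWeakSubslope ℓ₁ m₁ g z := by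
      have hone := (ae_iff_ae_comp hTmeas hST.injective hTpush).1
        (one_le_maxWeakSubslope_separationFrom (m := m₂) hr₂ hfin₂ husc₂ (T x : M₂))
      refine ae_comap_support_iff.1 ?_
      filter_upwards [hslope _ hf, ae_comap_support_iff.2 hcongr, hone] with z h1 h2 h3
      rwa [h2, h1]
    have h2 := hS₁ g hg h1 x x.2 y y.2
    rw [hgT, hgT, le_extDiff_iff] at h2
    exact (le_add_of_nonneg_right (hr₂.diag_nonneg _)).trans h2
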